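/- For a tempered distribution $u$ on $\mathbb R^2$ (variables $(x,t)$) let $\widetilde u(\xi,\tau)$ denote its space-time Fourier transform, normalized by $\widetilde u(\xi,\tau)=\int_{\mathbb R^2} e^{-i(t\tau+x\xi)}u(x,t)\,dx\,dt$. For $\sigma\ge 0$ and $s,b\in\mathbb R$ let $X^{\sigma,s,b}$ be the space of tempered distributions $u$ such that $\widetilde u$ is a function and $$\|u\|_{X^{\sigma,s,b}}=\left\|e^{\sigma|\xi|}(1+|\xi|)^s(1+|\tau-\xi^3|)^b\,\widetilde u(\xi,\tau)\right\|_{L^2_{\tau,\xi}}<\infty .$$ Given $s>-3/4$, there exist $b\in(1/2,1)$, $b'\in(b,1)$ and $C>0$ (depending only on $s$) such that for all $\sigma\ge 0$ and all $u,v\in X^{\sigma,s,b}$ the product $uv$ exists, $\partial_x(uv)\in X^{\sigma,s,b'-1}$, and $$\|\partial_x(uv)\|_{X^{\sigma,s,b'-1}}\le C\,\|u\|_{X^{\sigma,s,b}}\,\|v\|_{X^{\sigma,s,b}} .$$ Here $uv$ is the tempered distribution whose space-time Fourier transform is the function $\widetilde{uv}=(2\pi)^{-2}\,\widetilde u*\widetilde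 v$, the convolution being absolutely convergent almost everywhere (for Schwartz functions this is the pointwise product). -/

import Mathlib

open MeasureTheory FourierTransform LineDeriv
open scoped SchwartzMap ENNReal

/-- The space-time plane `ℝ²`: coordinate `0` is the space variable `x` (dual variable `ξ`) and
coordinate `1` is the time variable `t` (dual variable `τ`). -/
abbrev Spacetime : Type := EuclideanSpace ℝ (Fin 2)

/-- The unit vector in the `x`-direction. -/
noncomputable def dirX : Spacetime := EuclideanSpace.single 0 1

/-- `f` is the space-time Fourier transform `ũ` of the tempered distribution `u`, in the
normalization `ũ(ξ, τ) = ∫ e^{-i(tτ + xξ)} u(x, t) dx dt`. Since Mathlib's transform uses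
`e^{-2πi(tτ + xξ)}`, this says that `𝓕 u` is the (absolutely integrable against Schwartz functions)
function `ζ ↦ f (2π ζ)`. -/
def IsSpacetimeFourier (u : 𝓢'(Spacetime, ℂ)) (f : Spacetime → ℂ) : Prop :=
  ∀ φ : 𝓢(Spacetime, ℂ),
    Integrable (fun ζ : Spacetime => φ ζ * f ((2 * Real.pi) • ζ)) ∧
      𝓕 u φ = ∫ ζ : Spacetime, φ ζ * f ((2 * Real.pi) • ζ)

/-- The weight `e^{σ|ξ|} (1 + |ξ|)^s (1 + |τ - ξ³|)^b`. -/
noncomputable def bourgainWeight (σ s b : ℝ) (ζ : Spacetime) : ℝ :=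
  Real.exp (σ * |ζ 0|) * (1 + |ζ 0|) ^ s * (1 + |ζ 1 - ζ 0 ^ 3|) ^ b

/-- The function `ũ` is unique almost everywhere. -/
theorem IsSpacetimeFourier.ae_eq {u : 𝓢'(Spacetime, ℂ)} {f g : Spacetime → ℂ}
    (hf : IsSpacetimeFourier u f) (hg : IsSpacetimeFourier u g) : f =ᵐ[volume] g := by
  have hpi : (2 * Real.pi) ≠ 0 := by positivity
  have hloc : ∀ {h : Spacetime → ℂ}, IsSpacetimeFourier u h →
      LocallyIntegrable (fun ζ : Spacetime => h ((2 * Real.pi) • ζ)) volume := by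
    intro h hh x
    let β : ContDiffBump x := ⟨1, 2, one_pos, one_lt_two⟩
    have hc : HasCompactSupport (fun y => (β y : ℂ)) :=
      β.hasCompactSupport.comp_left Complex.ofReal_zero
    have hd : ContDiff ℝ (⊤ : ℕ∞) (fun y => (β y : ℂ)) :=
      Complex.ofRealCLM.contDiff.comp β.contDiff
    have hi := (hh (hc.toSchwartzMap hd)).1
    refine ⟨Metric.closedBall x 1, Metric.closedBall_mem_nhds x one_pos, ?_⟩
    refine (hi.integrableOn (s := Metric.closedBall x 1)).congr_fun (fun y hy => ?_)
      measurableSet_closedBall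
    have : β y = 1 := β.one_of_mem_closedBall hy
    simp [this]
  have h := ae_eq_of_integral_contDiff_smul_eq (hloc hf) (hloc hg) (fun φ hφ hφc => by
    have hc : HasCompactSupport (fun y => (φ y : ℂ)) := hφc.comp_left Complex.ofReal_zero
    have hd : ContDiff ℝ (⊤ : ℕ∞) (fun y => (φ y : ℂ)) := Complex.ofRealCLM.contDiff.comp hφ
    have := (hf (hc.toSchwartzMap hd)).2.symm.trans (hg (hc.toSchwartzMap hd)).2
    simpa using this)
  have hq : Measure.QuasiMeasurePreserving (fun ζ : Spacetime => (2 * Real.pi)⁻¹ • ζ)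
      volume volume := by
    refine ⟨by fun_prop, ?_⟩
    rw [Measure.map_addHaar_smul _ (inv_ne_zero hpi)]
    exact Measure.smul_absolutelyContinuous
  filter_upwards [hq.ae h] with ζ hζ
  simpa only [smul_inv_smul₀ hpi] using hζ

/-- The norm of `X^{σ,s,b}` on tempered distributions: the `L²(dξ dτ)` norm of the weight times
`ũ`. The function `ũ` is unique almost everywhere, so the infimum is over a single value, or over
the empty set when `ũ` is not a function; the norm is `∞` in the latter case. -/
noncomputable def bourgainNorm (σ s b : ℝ) (u : 𝓢'(Spacetime, ℂ)) : ℝ≥0∞ :=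
  ⨅ (f : Spacetime → ℂ) (_ : IsSpacetimeFourier u f),
    eLpNorm (fun ζ => (bourgainWeight σ s b ζ : ℂ) * f ζ) 2 volume

/-- The space `X^{σ,s,b}`: all tempered distributions of finite norm. -/
def MemBourgain (σ s b : ℝ) (u : 𝓢'(Spacetime, ℂ)) : Prop :=
  bourgainNorm σ s b u < ∞

/-- `p` is the product `u v` of two tempered distributions whose Fourier transforms are functions:
the convolution of `ũ` and `ṽ` converges absolutely almost everywhere, and
`p̃ = (2π)⁻² ũ ∗ ṽ`. At most one `p` has this property. -/
def IsProduct (u v p : 𝓢'(Spacetime, ℂ)) : Prop :=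
  ∃ f g : Spacetime → ℂ, IsSpacetimeFourier u f ∧ IsSpacetimeFourier v g ∧
    (∀ᵐ ζ : Spacetime, Integrable (fun η : Spacetime => f (ζ - η) * g η)) ∧
    IsSpacetimeFourier p
      (fun ζ => ((2 * Real.pi) ^ 2 : ℂ)⁻¹ * ∫ η : Spacetime, f (ζ - η) * g η)

/-- For a Schwartz function `u`, the rescaled integral `ũ(2πζ)` is Mathlib's transform. -/
theorem spacetimeFourier_rescale (u : 𝓢(Spacetime, ℂ)) (ζ : Spacetime) :
    (∫ z : Spacetime, Complex.exp (-Complex.I *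
      (z 1 * ((2 * Real.pi) • ζ) 1 + z 0 * ((2 * Real.pi) • ζ) 0)) * u z) = 𝓕 u ζ := by
  rw [SchwartzMap.fourier_coe, Real.fourier_eq']
  refine integral_congr_ae (Filter.Eventually.of_forall fun z => ?_)
  simp only [smul_eq_mul, PiLp.inner_apply, Fin.sum_univ_two, PiLp.smul_apply]
  congr 2
  simp
  ring

/-- On Schwartz functions `IsSpacetimeFourier` is the integral formula. -/
theorem isSpacetimeFourier_schwartz (u : 𝓢(Spacetime, ℂ)) :
    IsSpacetimeFourier (u : 𝓢'(Spacetime, ℂ)) (fun ζ => ∫ z : Spacetime,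
      Complex.exp (-Complex.I * (z 1 * ζ 1 + z 0 * ζ 0)) * u z) := by
  intro φ
  simp only [spacetimeFourier_rescale]
  refine ⟨(SchwartzMap.pairing (ContinuousLinearMap.mul ℂ ℂ) φ (𝓕 u)).integrable, ?_⟩
  rw [TemperedDistribution.fourier_toTemperedDistributionCLM_eq]
  simp

/-- Mathlib's transform turns products of Schwartz functions into convolutions. -/
theorem fourier_pairing_mul (u v : 𝓢(Spacetime, ℂ)) (ζ : Spacetime) :
    𝓕 (SchwartzMap.pairing (ContinuousLinearMap.mul ℂ ℂ) u v) ζ =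
      ∫ η : Spacetime, 𝓕 u (ζ - η) * 𝓕 v η := by
  have h := SchwartzMap.convolution_apply (ContinuousLinearMap.mul ℂ ℂ) (𝓕⁻ v) (𝓕⁻ u) (-ζ)
  have h2 : SchwartzMap.convolution (ContinuousLinearMap.mul ℂ ℂ) (𝓕⁻ v) (𝓕⁻ u) =
      𝓕⁻ (SchwartzMap.pairing (ContinuousLinearMap.mul ℂ ℂ) u v) := by
    have h3 := SchwartzMap.fourier_convolution (ContinuousLinearMap.mul ℂ ℂ) (𝓕⁻ v) (𝓕⁻ u)
    rw [fourier_fourierInv_eq, fourier_fourierInv_eq] at h3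
    rw [← fourierInv_fourier_eq (F := 𝓢(Spacetime, ℂ)) (SchwartzMap.convolution
      (ContinuousLinearMap.mul ℂ ℂ) (𝓕⁻ v) (𝓕⁻ u)), h3]
    congr 1
    ext x
    simp [mul_comm]
  have inv : ∀ (w : 𝓢(Spacetime, ℂ)) (x : Spacetime), 𝓕⁻ w x = 𝓕 w (-x) := by
    intro w x
    rw [SchwartzMap.fourierInv_coe, SchwartzMap.fourier_coe, Real.fourierInv_eq_fourier_neg]
  rw [h2, inv, neg_neg] at h
  rw [h, MeasureTheory.convolution_def, ← integral_neg_eq_self]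
  refine integral_congr_ae (Filter.Eventually.of_forall fun η => ?_)
  simp only [ContinuousLinearMap.mul_apply', inv, neg_neg]
  rw [mul_comm]
  congr 2
  abel

/-- On Schwartz functions `IsProduct` is the pointwise product. -/
theorem isProduct_schwartz (u v : 𝓢(Spacetime, ℂ)) :
    IsProduct (u : 𝓢'(Spacetime, ℂ)) (v : 𝓢'(Spacetime, ℂ))
      (SchwartzMap.pairing (ContinuousLinearMap.mul ℂ ℂ) u v : 𝓢(Spacetime, ℂ)) := by
  have hpi : (2 * Real.pi) ≠ 0 := by positivity
  refine ⟨_, _, isSpacetimeFourier_schwartz u, isSpacetimeFourier_schwartz v, ?_, ?_⟩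
  · refine Filter.Eventually.of_forall fun ζ => ?_
    rw [← integrable_comp_smul_iff volume _ hpi]
    have h : ∀ η : Spacetime, ζ - (2 * Real.pi) • η =
        (2 * Real.pi) • ((2 * Real.pi)⁻¹ • ζ - η) := by
      intro η
      rw [smul_sub, smul_inv_smul₀ hpi]
    simp only [h, spacetimeFourier_rescale]
    refine (SchwartzMap.integrable (𝓕 v)).bdd_mul
      (c := SchwartzMap.seminorm ℝ 0 0 (𝓕 u)) ?_ ?_
    · exact ((𝓕 u).continuous.comp (by fun_prop)).aestronglyMeasurable
    · exact Filter.Eventually.of_forall fun η => SchwartzMap.norm_le_seminorm ℝ _ _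
  · have key : ∀ ζ : Spacetime, ((2 * Real.pi) ^ 2 : ℂ)⁻¹ * (∫ η : Spacetime,
        (∫ z : Spacetime, Complex.exp (-Complex.I * (z 1 * ((2 * Real.pi) • ζ - η) 1 +
          z 0 * ((2 * Real.pi) • ζ - η) 0)) * u z) *
        (∫ z : Spacetime, Complex.exp (-Complex.I * (z 1 * η 1 + z 0 * η 0)) * v z)) =
        𝓕 (SchwartzMap.pairing (ContinuousLinearMap.mul ℂ ℂ) u v) ζ := by
      intro ζ
      have hs := Measure.integral_comp_smul (volume : Measure Spacetime) (fun η : Spacetime =>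
        (∫ z : Spacetime, Complex.exp (-Complex.I * (z 1 * ((2 * Real.pi) • ζ - η) 1 +
          z 0 * ((2 * Real.pi) • ζ - η) 0)) * u z) *
        (∫ z : Spacetime, Complex.exp (-Complex.I * (z 1 * η 1 + z 0 * η 0)) * v z))
        (2 * Real.pi)
      simp only [← smul_sub, spacetimeFourier_rescale] at hs
      rw [fourier_pairing_mul, hs, finrank_euclideanSpace_fin,
        abs_of_nonneg (by positivity), Complex.real_smul]
      push_cast
      rfl
    intro φ
    simp only [key]
    refine ⟨(SchwartzMap.pairing (ContinuousLinearMap.mul ℂ ℂ) φ (𝓕 _)).integrable, ?_⟩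
    rw [TemperedDistribution.fourier_toTemperedDistributionCLM_eq]
    simp

/-! Write $p=2(1-b')$, $q=2b$, $\zeta=(\xi,\tau)$ for the output frequency, $\eta=(\xi_1,\tau_1)$
and $\zeta-\eta$ for the input frequencies. On the Fourier side the estimate is an $L^2$ bound for a
bilinear form with a positive kernel. Since $|\xi|\le|\xi_1|+|\xi-\xi_1|$, the factors
$e^{\sigma|\cdot|}$ are submultiplicative and drop out, which makes the constant independent of
$\sigma$; since $1+|\xi|\le(1+|\xi_1|)(1+|\xi-\xi_1|)$, the exponent $s$ may be lowered to some
$-\rho$ with $1/2\le\rho<3/4$ (`abs_mul_bourgainWeight_le`).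

The kernel is treated by the method of Kenig, Ponce and Vega. The three modulations differ by
$3\xi\xi_1(\xi-\xi_1)$, so the largest of them controls $|\xi\xi_1(\xi-\xi_1)|$, which pays for the
derivative and for the negative $\rho$-weights. If the output modulation is largest, or an input
frequency is small, the squared kernel is integrated over the inputs
(`exists_lintegral_outputRegion_le`); if an input modulation is largest, it is integrated over the
output (`exists_lintegral_inputRegion_le`) and duality is used. In both cases the time integral
collapses two brackets into one, whose phase is quadratic in the remaining frequency, and
`exists_lintegral_quadratic_le` finishes. `exists_lintegral_sq_kdvKernel_le` assembles the pieces by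
Cauchy-Schwarz.

The product has to be constructed separately. The substitution $y=\xi^3$ gives a local smoothing
bound placing $\tilde u$ and $\tilde v$ in $L^2_\tau L^1_\xi$; their convolution is then integrable
against $(1+|\tau|)^{-2}$ (`exists_lintegral_convolution_le`). Hence it converges absolutely almost
everywhere and is the transform of a tempered distribution. -/

/-! ### Cauchy-Schwarz and duality for positive kernels. -/

section Abstract

variable {α β : Type*} [MeasurableSpace α] [MeasurableSpace β]

/-- The Cauchy-Schwarz inequality for lower Lebesgue integrals, in squared form. -/
theorem sq_lintegral_mul_le (μ : Measure α) {f g : α → ℝ≥0∞} (hf : AEMeasurable f μ)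
    (hg : AEMeasurable g μ) :
    (∫⁻ x, f x * g x ∂μ) ^ 2 ≤ (∫⁻ x, f x ^ 2 ∂μ) * ∫⁻ x, g x ^ 2 ∂μ := by
  have h := ENNReal.lintegral_mul_le_Lp_mul_Lq μ Real.HolderConjugate.two_two hf hg
  have h2 : ∀ a : ℝ≥0∞, (a ^ (1 / (2 : ℝ))) ^ 2 = a := by
    intro a
    rw [← ENNReal.rpow_natCast, ← ENNReal.rpow_mul]
    norm_num
  calc (∫⁻ x, f x * g x ∂μ) ^ 2
      ≤ ((∫⁻ x, f x ^ (2 : ℝ) ∂μ) ^ (1 / (2 : ℝ)) *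
          (∫⁻ x, g x ^ (2 : ℝ) ∂μ) ^ (1 / (2 : ℝ))) ^ 2 := by
        gcongr
        exact h
    _ = (∫⁻ x, f x ^ 2 ∂μ) * ∫⁻ x, g x ^ 2 ∂μ := by
        rw [mul_pow, h2, h2]
        simp only [ENNReal.rpow_two]

/-- A bilinear form whose kernel is square integrable in one variable, uniformly in the other. -/
theorem sq_lintegral_kernel_le (μ : Measure α) (ν : Measure β) [SFinite ν]
    {Φ : α → ℝ≥0∞} {k Ψ : α → β → ℝ≥0∞} (hΦ : Measurable Φ)
    (hk : Measurable (Function.uncurry k)) (hΨ : Measurable (Function.uncurry Ψ)) {C : ℝ≥0∞}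
    (hC : ∀ x, ∫⁻ y, k x y ^ 2 ∂ν ≤ C) :
    (∫⁻ x, Φ x * ∫⁻ y, k x y * Ψ x y ∂ν ∂μ) ^ 2 ≤
      C * (∫⁻ x, Φ x ^ 2 ∂μ) * ∫⁻ x, ∫⁻ y, Ψ x y ^ 2 ∂ν ∂μ := by
  have hm : Measurable fun x => ∫⁻ y, k x y * Ψ x y ∂ν :=
    Measurable.lintegral_prod_right' (f := fun z : α × β => k z.1 z.2 * Ψ z.1 z.2) (hk.mul hΨ)
  refine (sq_lintegral_mul_le μ hΦ.aemeasurable hm.aemeasurable).trans ?_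
  rw [mul_comm C, mul_assoc]
  gcongr
  rw [← lintegral_const_mul]
  · refine lintegral_mono fun x => ?_
    refine (sq_lintegral_mul_le ν (hk.comp measurable_prodMk_left).aemeasurable
      (hΨ.comp measurable_prodMk_left).aemeasurable).trans ?_
    exact mul_le_mul' (hC x) le_rfl
  · exact Measurable.lintegral_prod_right' (f := fun z : α × β => Ψ z.1 z.2 ^ 2) (hΨ.pow_const 2)

/-- The `L²` norm is at most the norm of the induced functional on `L²`. -/
theorem lintegral_sq_le_of_forall_sq_lintegral_mul_le (μ : Measure α) [SigmaFinite μ]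
    {L : α → ℝ≥0∞} (hL : Measurable L) {C : ℝ≥0∞}
    (h : ∀ H : α → ℝ≥0∞, Measurable H → (∫⁻ x, H x * L x ∂μ) ^ 2 ≤ C * ∫⁻ x, H x ^ 2 ∂μ) :
    ∫⁻ x, L x ^ 2 ∂μ ≤ C := by
  classical
  -- Testing against `L` itself would require its norm to be finite. Bounded truncations on sets of
  -- finite measure have finite norm, so that norm can be cancelled, and they increase to `L`.
  let H : ℕ → α → ℝ≥0∞ := fun n => (spanningSets μ n).indicator fun x => min (L x) n
  have hHm : ∀ n, Measurable (H n) := fun n =>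
    (hL.min measurable_const).indicator (measurableSet_spanningSets μ n)
  have hHL : ∀ n x, H n x ≤ L x := fun n x => by
    by_cases hx : x ∈ spanningSets μ n <;> simp [H, hx]
  have hmono : Monotone H := by
    intro m n hmn x
    by_cases hx : x ∈ spanningSets μ m
    · have hx' := monotone_spanningSets μ hmn hx
      simp only [H, Set.indicator_of_mem hx, Set.indicator_of_mem hx']
      gcongr
    · simp [H, hx]
  have hsup : ∀ x, ⨆ n, H n x ^ 2 = L x ^ 2 := by
    intro x
    have hmem : ∀ᶠ n in Filter.atTop, x ∈ spanningSets μ n := by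
      filter_upwards [Filter.eventually_ge_atTop (spanningSetsIndex μ x)] with n hn
      exact monotone_spanningSets μ hn (mem_spanningSetsIndex μ x)
    have ht : Filter.Tendsto (fun n => H n x) Filter.atTop (nhds (L x)) := by
      have : Filter.Tendsto (fun n : ℕ => min (L x) (n : ℝ≥0∞)) Filter.atTop
          (nhds (min (L x) ⊤)) := tendsto_const_nhds.min ENNReal.tendsto_nat_nhds_top
      rw [min_top_right] at this
      refine this.congr' ?_
      filter_upwards [hmem] with n hn
      simp [H, hn]
    exact tendsto_nhds_unique (tendsto_atTop_iSup fun m n hmn => by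
      have := hmono hmn x
      gcongr) (((ENNReal.continuous_pow 2).tendsto _).comp ht)
  rw [← lintegral_congr hsup, lintegral_iSup (fun n => (hHm n).pow_const 2) (fun m n hmn x => by
    have := hmono hmn x
    dsimp only
    gcongr)]
  refine iSup_le fun n => ?_
  set I := ∫⁻ x, H n x ^ 2 ∂μ with hI
  have hfin : I ≠ ∞ := by
    refine ne_top_of_le_ne_top (b := (n : ℝ≥0∞) ^ 2 * μ (spanningSets μ n))
      (ENNReal.mul_ne_top (by simp) (measure_spanningSets_lt_top μ n).ne) ?_
    rw [← lintegral_indicator_const (measurableSet_spanningSets μ n)]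
    refine lintegral_mono fun x => ?_
    by_cases hx : x ∈ spanningSets μ n
    · simp only [H, hx, Set.indicator_of_mem]
      gcongr
      exact min_le_right _ _
    · simp [H, hx]
  have h1 : I ≤ ∫⁻ x, H n x * L x ∂μ := lintegral_mono fun x => by
    dsimp only
    rw [pow_two]
    gcongr
    exact hHL n x
  have h2 : I * I ≤ C * I := by
    rw [← pow_two]
    calc I ^ 2 ≤ (∫⁻ x, H n x * L x ∂μ) ^ 2 := by gcongr
      _ ≤ C * I := h _ (hHm n)
  by_cases h0 : I = 0
  · simp [h0]
  · exact (ENNReal.mul_le_mul_iff_left h0 hfin).1 h2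

end Abstract

/-! ### Coordinates on the plane. -/

/-- Coordinates on the space-time plane. -/
noncomputable def spacetimeEquiv : Spacetime ≃ᵐ ℝ × ℝ :=
  (MeasurableEquiv.toLp 2 (Fin 2 → ℝ)).symm.trans MeasurableEquiv.finTwoArrow

theorem measurePreserving_spacetimeEquiv :
    MeasurePreserving spacetimeEquiv volume (volume.prod volume) :=
  (volume_preserving_finTwoArrow ℝ).comp (PiLp.volume_preserving_ofLp (Fin 2))

theorem lintegral_spacetime {Φ : ℝ → ℝ → ℝ≥0∞} (hΦ : Measurable (Function.uncurry Φ)) :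
    ∫⁻ ζ : Spacetime, Φ (ζ 0) (ζ 1) = ∫⁻ ξ, ∫⁻ τ, Φ ξ τ := by
  exact (measurePreserving_spacetimeEquiv.lintegral_comp hΦ).trans
    (lintegral_prod (Function.uncurry Φ) hΦ.aemeasurable)

/-! ### One-variable integrals of brackets with linear and quadratic phases. -/

/-- A translated and dilated integrable bracket. -/
theorem exists_lintegral_bracket_le {q : ℝ} (hq : 1 < q) :
    ∃ C : ℝ, 0 < C ∧ ∀ c : ℝ, 0 < c → ∀ a : ℝ,
      ∫⁻ y : ℝ, ENNReal.ofReal ((1 + c * |y - a|) ^ (-q)) ≤ ENNReal.ofReal (C / c) := by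
  have hfin := finite_integral_one_add_norm (E := ℝ) (μ := volume) (r := q) (by simpa using hq)
  simp only [Real.norm_eq_abs] at hfin
  set I := ∫⁻ y : ℝ, ENNReal.ofReal ((1 + |y|) ^ (-q)) with hI
  refine ⟨I.toReal + 1, by positivity, fun c hc a => ?_⟩
  have hm : Measurable fun y : ℝ => ENNReal.ofReal ((1 + |y|) ^ (-q)) := by fun_prop
  have h1 : ∫⁻ y : ℝ, ENNReal.ofReal ((1 + c * |y - a|) ^ (-q)) = ENNReal.ofReal c⁻¹ * I := by
    have h2 : ∀ y : ℝ, c * |y - a| = |c * (y - a)| := fun y => by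
      rw [abs_mul, abs_of_pos hc]
    simp only [h2]
    rw [lintegral_sub_right_eq_self (fun y => ENNReal.ofReal ((1 + |c * y|) ^ (-q))) a,
      ← lintegral_map (μ := volume) (f := fun y : ℝ => ENNReal.ofReal ((1 + |y|) ^ (-q)))
        (g := fun y => c * y) hm (by fun_prop), Real.map_volume_mul_left hc.ne',
      lintegral_smul_measure, abs_of_pos (inv_pos.2 hc)]
    rfl
  rw [h1, div_eq_inv_mul, ENNReal.ofReal_mul (by positivity)]
  gcongr
  rw [ENNReal.le_ofReal_iff_toReal_le hfin.ne (by positivity)]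
  linarith

theorem bracket_rpow_neg_le {x y r : ℝ} (hx : 0 < x) (hxy : x ≤ y) (hr : 0 ≤ r) :
    y ^ (-r) ≤ x ^ (-r) :=
  Real.rpow_le_rpow_of_nonpos hx hxy (by linarith)

theorem div_rpow_neg_eq {x c : ℝ} (hx : 0 ≤ x) (hc : 0 < c) (r : ℝ) :
    (x / c) ^ (-r) = c ^ r * x ^ (-r) := by
  rw [Real.div_rpow hx hc.le, Real.rpow_neg hc.le, div_inv_eq_mul, mul_comm]

theorem exists_lintegral_bracket_abs_le {q : ℝ} (hq : 1 < q) :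
    ∃ C : ℝ, 0 < C ∧ ∀ c : ℝ, 0 < c → ∀ a : ℝ,
      ∫⁻ y : ℝ, ENNReal.ofReal ((1 + c * |(|y| - a)|) ^ (-q)) ≤ ENNReal.ofReal (C / c) := by
  obtain ⟨C, hC, h⟩ := exists_lintegral_bracket_le hq
  refine ⟨2 * C, by positivity, fun c hc a => ?_⟩
  calc ∫⁻ y : ℝ, ENNReal.ofReal ((1 + c * |(|y| - a)|) ^ (-q))
      ≤ ∫⁻ y : ℝ, (ENNReal.ofReal ((1 + c * |y - a|) ^ (-q)) +
          ENNReal.ofReal ((1 + c * |y - (-a)|) ^ (-q))) := by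
        refine lintegral_mono fun y => ?_
        dsimp only
        rcases abs_cases y with ⟨hy, -⟩ | ⟨hy, -⟩
        · rw [hy]
          exact le_self_add
        · rw [hy, show |y - -a| = |-y - a| by rw [← abs_neg]; congr 1; ring]
          exact le_add_self
    _ = (∫⁻ y : ℝ, ENNReal.ofReal ((1 + c * |y - a|) ^ (-q))) +
          ∫⁻ y : ℝ, ENNReal.ofReal ((1 + c * |y - (-a)|) ^ (-q)) :=
        lintegral_add_left (by fun_prop) _
    _ ≤ ENNReal.ofReal (C / c) + ENNReal.ofReal (C / c) := add_le_add (h c hc a) (h c hc (-a))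
    _ = ENNReal.ofReal (2 * C / c) := by
        rw [← ENNReal.ofReal_add (by positivity) (by positivity)]
        congr 1
        ring

/-- Factorization of a quadratic, with its nonnegative root. -/
theorem exists_root_le_abs_quadratic {k : ℝ} (hk : k ≠ 0) (A : ℝ) :
    ∃ a : ℝ, (∀ y : ℝ, |k| * |y| * |(|y| - a)| ≤ |A - k * y ^ 2|) ∧
      ∀ y : ℝ, √(|A| * |k|) * |(|y| - a)| ≤ |A - k * y ^ 2| := by
  have hk' : 0 < |k| := abs_pos.2 hk
  have hquad : ∀ y : ℝ, |A - k * y ^ 2| = |k| * |A / k - |y| ^ 2| := by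
    intro y
    rw [← abs_mul, mul_sub, mul_div_cancel₀ A hk, sq_abs]
  have hA : |A| = |k| * |A / k| := by
    rw [← abs_mul, mul_div_cancel₀ A hk]
  -- With real roots, $A-ky^2=k(a+|y|)(a-|y|)$ for $a=\sqrt{A/k}$; dropping $a$ or $|y|$ from the
  -- first factor gives the two bounds. Without real roots nothing cancels and $a=0$ works.
  rcases le_total 0 (A / k) with h | h
  · have hs : √(A / k) ^ 2 = A / k := Real.sq_sqrt h
    have hfac : ∀ y : ℝ, |A - k * y ^ 2| = |k| * ((√(A / k) + |y|) * |(|y| - √(A / k))|) := by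
      intro y
      have h0 : (0 : ℝ) ≤ √(A / k) + |y| := by positivity
      have h1 : A / k - |y| ^ 2 = -((√(A / k) + |y|) * (|y| - √(A / k))) := by
        linear_combination -hs
      rw [hquad, h1, abs_neg, abs_mul, abs_of_nonneg h0]
    refine ⟨√(A / k), fun y => ?_, fun y => ?_⟩
    · rw [hfac, mul_assoc]
      gcongr
      linarith [Real.sqrt_nonneg (A / k)]
    · have : √(|A| * |k|) = |k| * √(A / k) := by
        rw [hA, abs_of_nonneg h, show |k| * (A / k) * |k| = |k| ^ 2 * (A / k) by ring,
          Real.sqrt_mul (by positivity), Real.sqrt_sq hk'.le]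
      rw [hfac, this, mul_assoc]
      gcongr
      linarith [abs_nonneg y]
  · have hfac : ∀ y : ℝ, |A - k * y ^ 2| = |k| * (|A / k| + |y| ^ 2) := by
      intro y
      have h1 : A / k - |y| ^ 2 ≤ 0 := by linarith [sq_nonneg |y|]
      rw [hquad, abs_of_nonpos h, abs_of_nonpos h1]
      ring
    refine ⟨0, fun y => ?_, fun y => ?_⟩
    · rw [hfac, sub_zero, abs_abs, mul_assoc]
      gcongr
      nlinarith [abs_nonneg (A / k)]
    · have : √(|A| * |k|) = |k| * √|A / k| := by
        rw [hA, show |k| * |A / k| * |k| = |k| ^ 2 * |A / k| by ring,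
          Real.sqrt_mul (by positivity), Real.sqrt_sq hk'.le]
      rw [hfac, this, sub_zero, abs_abs, mul_assoc]
      gcongr
      nlinarith [Real.sq_sqrt (abs_nonneg (A / k)), sq_nonneg (√|A / k| - |y|),
        abs_nonneg (A / k), sq_nonneg |y|]

/-- Away from the vertex a quadratic phase is nonsingular. -/
theorem exists_setLIntegral_quadratic_le {q : ℝ} (hq : 1 < q) :
    ∃ C : ℝ, 0 < C ∧ ∀ k : ℝ, k ≠ 0 → ∀ c : ℝ, 0 < c → ∀ A : ℝ,
      ∫⁻ y in {y : ℝ | c ≤ |y|}, ENNReal.ofReal ((1 + |A - k * y ^ 2|) ^ (-q)) ≤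
        ENNReal.ofReal (C / (|k| * c)) := by
  obtain ⟨C, hC, h⟩ := exists_lintegral_bracket_abs_le hq
  refine ⟨C, hC, fun k hk c hc A => ?_⟩
  have hk' : 0 < |k| := abs_pos.2 hk
  obtain ⟨a, ha, -⟩ := exists_root_le_abs_quadratic hk A
  refine le_trans ?_ (h (|k| * c) (by positivity) a)
  refine (setLIntegral_mono (by fun_prop) fun y hy => ?_).trans (setLIntegral_le_lintegral _ _)
  refine ENNReal.ofReal_le_ofReal (bracket_rpow_neg_le (by positivity) ?_ (by linarith))
  have hy' : c ≤ |y| := hy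
  have : |k| * c * |(|y| - a)| ≤ |k| * |y| * |(|y| - a)| := by gcongr
  linarith [ha y]

/-- The stationary phase bound for a quadratic phase. -/
theorem exists_lintegral_quadratic_le {q : ℝ} (hq : 1 < q) :
    ∃ C : ℝ, 0 < C ∧ ∀ k : ℝ, k ≠ 0 → ∀ A : ℝ,
      ∫⁻ y : ℝ, ENNReal.ofReal ((1 + |A - k * y ^ 2|) ^ (-q)) ≤
        ENNReal.ofReal (C / (√|k| * √(1 + |A|))) := by
  obtain ⟨C, hC, h⟩ := exists_lintegral_bracket_abs_le hq
  refine ⟨4 ^ q * C * 2, by positivity, fun k hk A => ?_⟩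
  have hk' : 0 < √|k| := Real.sqrt_pos.2 (abs_pos.2 hk)
  have hksq : √|k| ^ 2 = |k| := Real.sq_sqrt (abs_nonneg k)
  have h4 : (1 : ℝ) ≤ 4 ^ q := Real.one_le_rpow (by norm_num) (by linarith)
  -- For bounded $A$ the scale is $|y|\sim|k|^{-1/2}$. For large $A$ the phase is at least linear
  -- about its roots, with slope $\sqrt{|A||k|}$.
  rcases le_total |A| 1 with hA | hA
  · have hsA : √(1 + |A|) ≤ 2 := by
      rw [Real.sqrt_le_left (by norm_num)]
      linarith
    have hsA' : 0 < √(1 + |A|) := Real.sqrt_pos.2 (by positivity)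
    calc ∫⁻ y : ℝ, ENNReal.ofReal ((1 + |A - k * y ^ 2|) ^ (-q))
        ≤ ∫⁻ y : ℝ, ENNReal.ofReal (4 ^ q) *
            ENNReal.ofReal ((1 + √|k| * |(|y| - 0)|) ^ (-q)) := by
          refine lintegral_mono fun y => ?_
          dsimp only
          rw [← ENNReal.ofReal_mul (by positivity), sub_zero, abs_abs]
          refine ENNReal.ofReal_le_ofReal ?_
          have h1 : (1 + √|k| * |y|) / 4 ≤ 1 + |A - k * y ^ 2| := by
            have h2 : |k * y ^ 2| ≤ |A - k * y ^ 2| + |A| := by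
              have := abs_sub_abs_le_abs_sub (k * y ^ 2) A
              rw [abs_sub_comm] at this
              linarith
            have h3 : |k * y ^ 2| = (√|k| * |y|) ^ 2 := by
              rw [mul_pow, hksq, abs_mul, abs_pow]
            have h4 : 0 ≤ |A - k * y ^ 2| := abs_nonneg _
            rw [h3] at h2
            nlinarith [sq_nonneg (√|k| * |y| - 1 / 2)]
          calc (1 + |A - k * y ^ 2|) ^ (-q) ≤ ((1 + √|k| * |y|) / 4) ^ (-q) :=
                bracket_rpow_neg_le (by positivity) h1 (by linarith)
            _ = 4 ^ q * (1 + √|k| * |y|) ^ (-q) :=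
                div_rpow_neg_eq (by positivity) (by norm_num) q
      _ = ENNReal.ofReal (4 ^ q) * ∫⁻ y : ℝ, ENNReal.ofReal ((1 + √|k| * |(|y| - 0)|) ^ (-q)) :=
          lintegral_const_mul _ (by fun_prop)
      _ ≤ ENNReal.ofReal (4 ^ q) * ENNReal.ofReal (C / √|k|) := by
          gcongr
          exact h _ hk' 0
      _ ≤ ENNReal.ofReal (4 ^ q * C * 2 / (√|k| * √(1 + |A|))) := by
          rw [← ENNReal.ofReal_mul (by positivity)]
          refine ENNReal.ofReal_le_ofReal ?_
          rw [← mul_div_assoc, div_le_div_iff₀ hk' (by positivity)]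
          have : 0 ≤ 4 ^ q * C * √|k| := by positivity
          nlinarith
  · obtain ⟨a, -, ha⟩ := exists_root_le_abs_quadratic hk A
    have hm : √(|A| * |k|) = √|A| * √|k| := Real.sqrt_mul (abs_nonneg A) _
    have hA' : 0 < √|A| := Real.sqrt_pos.2 (by linarith)
    have hsA : √(1 + |A|) ≤ 2 * √|A| := by
      rw [Real.sqrt_le_left (by positivity), mul_pow, Real.sq_sqrt (abs_nonneg A)]
      linarith
    have hsA' : 0 < √(1 + |A|) := Real.sqrt_pos.2 (by positivity)
    refine le_trans ?_ ((h (√(|A| * |k|)) (by rw [hm]; positivity) a).trans ?_)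
    · refine lintegral_mono fun y => ENNReal.ofReal_le_ofReal
        (bracket_rpow_neg_le (by positivity) ?_ (by linarith))
      linarith [ha y]
    · refine ENNReal.ofReal_le_ofReal ?_
      rw [hm, div_le_div_iff₀ (by positivity) (by positivity)]
      calc C * (√|k| * √(1 + |A|)) ≤ C * (√|k| * (2 * √|A|)) := by gcongr
        _ = 1 * (C * 2 * (√|A| * √|k|)) := by ring
        _ ≤ 4 ^ q * (C * 2 * (√|A| * √|k|)) := by gcongr
        _ = 4 ^ q * C * 2 * (√|A| * √|k|) := by ring

/-- A product of two brackets is dominated by the bracket of the difference. -/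
theorem bracket_mul_bracket_le {p q : ℝ} (hp : 0 ≤ p) (hpq : p ≤ q) (a b : ℝ) :
    (1 + |a|) ^ (-p) * (1 + |b|) ^ (-q) ≤
      2 ^ p * (1 + |a - b|) ^ (-p) * ((1 + |a|) ^ (-q) + (1 + |b|) ^ (-q)) := by
  have hhalf : ∀ x : ℝ, 0 ≤ x → |a - b| ≤ 2 * x →
      (1 + x) ^ (-p) ≤ 2 ^ p * (1 + |a - b|) ^ (-p) := by
    intro x hx h
    calc (1 + x) ^ (-p) ≤ ((1 + |a - b|) / 2) ^ (-p) :=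
          bracket_rpow_neg_le (by positivity) (by linarith) hp
      _ = 2 ^ p * (1 + |a - b|) ^ (-p) :=
          div_rpow_neg_eq (by positivity) (by norm_num) p
  have hab := abs_sub a b
  rcases le_total |b| |a| with h | h
  · have h1 := hhalf |a| (abs_nonneg a) (by linarith)
    have h2 : 0 ≤ (1 + |a|) ^ (-q) := by positivity
    calc (1 + |a|) ^ (-p) * (1 + |b|) ^ (-q)
        ≤ (2 ^ p * (1 + |a - b|) ^ (-p)) * (1 + |b|) ^ (-q) := by gcongr
      _ ≤ _ := by
        gcongr
        linarith
  · have h1 := hhalf |b| (abs_nonneg b) (by linarith)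
    have h2 : 0 ≤ (1 + |b|) ^ (-q) := by positivity
    calc (1 + |a|) ^ (-p) * (1 + |b|) ^ (-q)
        = (1 + |b|) ^ (-p) * ((1 + |a|) ^ (-p) * (1 + |b|) ^ (-(q - p))) := by
          rw [show -q = -p + -(q - p) by ring, Real.rpow_add (by positivity)]
          ring
      _ ≤ (2 ^ p * (1 + |a - b|) ^ (-p)) * ((1 + |a|) ^ (-p) * (1 + |a|) ^ (-(q - p))) := by
          have h3 : (1 + |b|) ^ (-(q - p)) ≤ (1 + |a|) ^ (-(q - p)) :=
            bracket_rpow_neg_le (by positivity) (by linarith) (by linarith)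
          gcongr
      _ = (2 ^ p * (1 + |a - b|) ^ (-p)) * (1 + |a|) ^ (-q) := by
          rw [← Real.rpow_add (by positivity)]
          ring_nf
      _ ≤ _ := by
        gcongr
        linarith

/-- Only the larger exponent has to exceed $1$: the larger of the two brackets is comparable to at
least $1+|u-v|$, which can be pulled out with exponent $-p$, leaving an integrable bracket. The case
$p<1$ is needed for the output modulation. -/
theorem exists_lintegral_bracket_mul_bracket_le {p q : ℝ} (hp : 0 ≤ p) (hpq : p ≤ q)
    (hq : 1 < q) :
    ∃ C : ℝ, 0 < C ∧ ∀ u v : ℝ,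
      ∫⁻ τ : ℝ, ENNReal.ofReal ((1 + |τ - u|) ^ (-p) * (1 + |τ - v|) ^ (-q)) ≤
        ENNReal.ofReal (C * (1 + |u - v|) ^ (-p)) := by
  obtain ⟨C, hC, h⟩ := exists_lintegral_bracket_le hq
  have h1 : ∀ a : ℝ, ∫⁻ y : ℝ, ENNReal.ofReal ((1 + |y - a|) ^ (-q)) ≤ ENNReal.ofReal C := by
    intro a
    simpa using h 1 one_pos a
  refine ⟨2 ^ p * (2 * C), by positivity, fun u v => ?_⟩
  calc ∫⁻ τ : ℝ, ENNReal.ofReal ((1 + |τ - u|) ^ (-p) * (1 + |τ - v|) ^ (-q))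
      ≤ ∫⁻ τ : ℝ, ENNReal.ofReal (2 ^ p * (1 + |u - v|) ^ (-p)) *
          (ENNReal.ofReal ((1 + |τ - u|) ^ (-q)) + ENNReal.ofReal ((1 + |τ - v|) ^ (-q))) := by
        refine lintegral_mono fun τ => ?_
        dsimp only
        rw [← ENNReal.ofReal_add (by positivity) (by positivity),
          ← ENNReal.ofReal_mul (by positivity)]
        refine ENNReal.ofReal_le_ofReal ((bracket_mul_bracket_le hp hpq _ _).trans_eq ?_)
        rw [show τ - u - (τ - v) = -(u - v) by ring, abs_neg]
    _ = ENNReal.ofReal (2 ^ p * (1 + |u - v|) ^ (-p)) *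
          ((∫⁻ τ : ℝ, ENNReal.ofReal ((1 + |τ - u|) ^ (-q))) +
            ∫⁻ τ : ℝ, ENNReal.ofReal ((1 + |τ - v|) ^ (-q))) := by
        rw [lintegral_const_mul _ (by fun_prop), lintegral_add_left (by fun_prop)]
    _ ≤ ENNReal.ofReal (2 ^ p * (1 + |u - v|) ^ (-p)) * (ENNReal.ofReal C + ENNReal.ofReal C) := by
        gcongr <;> exact h1 _
    _ = _ := by
        rw [← ENNReal.ofReal_add hC.le hC.le, ← ENNReal.ofReal_mul (by positivity)]
        congr 1
        ring

/-! ### The squared kernel, its regions and the resonance identity. -/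

/-- The square of the kernel of the bilinear form of `∂ₓ(uv)` in Bourgain spaces; `(ξ, τ)` is the
output frequency and `(ξ₁, τ₁)` one of the two input frequencies. -/
noncomputable def kdvKernelSq (ρ p q ξ τ ξ₁ τ₁ : ℝ) : ℝ :=
  ξ ^ 2 * (1 + |ξ|) ^ (-(2 * ρ)) * ((1 + |ξ₁|) * (1 + |ξ - ξ₁|)) ^ (2 * ρ) *
    (1 + |τ - ξ ^ 3|) ^ (-p) *
    ((1 + |τ₁ - ξ₁ ^ 3|) ^ (-q) * (1 + |τ - τ₁ - (ξ - ξ₁) ^ 3|) ^ (-q))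

/-- One input frequency is small, or the output modulation dominates. -/
def OutputRegion (ξ τ ξ₁ τ₁ : ℝ) : Prop :=
  (|ξ₁| ≤ 1 ∨ |ξ - ξ₁| ≤ 1) ∨
    (|τ₁ - ξ₁ ^ 3| ≤ |τ - ξ ^ 3| ∧ |τ - τ₁ - (ξ - ξ₁) ^ 3| ≤ |τ - ξ ^ 3|)

/-- Both input frequencies are large and the modulation of the first input dominates. -/
def InputRegion (ξ τ ξ₁ τ₁ : ℝ) : Prop :=
  (1 ≤ |ξ₁| ∧ 1 ≤ |ξ - ξ₁|) ∧
    (|τ - ξ ^ 3| ≤ |τ₁ - ξ₁ ^ 3| ∧ |τ - τ₁ - (ξ - ξ₁) ^ 3| ≤ |τ₁ - ξ₁ ^ 3|)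

theorem kdvKernelSq_nonneg (ρ p q ξ τ ξ₁ τ₁ : ℝ) : 0 ≤ kdvKernelSq ρ p q ξ τ ξ₁ τ₁ := by
  unfold kdvKernelSq
  positivity

theorem kdvKernelSq_symm (ρ p q ξ τ ξ₁ τ₁ : ℝ) :
    kdvKernelSq ρ p q ξ τ (ξ - ξ₁) (τ - τ₁) = kdvKernelSq ρ p q ξ τ ξ₁ τ₁ := by
  unfold kdvKernelSq
  rw [sub_sub_cancel, sub_sub_cancel, mul_comm (1 + |ξ - ξ₁|),
    mul_comm ((1 + |τ - τ₁ - (ξ - ξ₁) ^ 3|) ^ (-q))]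

theorem outputRegion_or_inputRegion (ξ τ ξ₁ τ₁ : ℝ) :
    OutputRegion ξ τ ξ₁ τ₁ ∨ InputRegion ξ τ ξ₁ τ₁ ∨ InputRegion ξ τ (ξ - ξ₁) (τ - τ₁) := by
  unfold OutputRegion InputRegion
  rw [sub_sub_cancel, sub_sub_cancel]
  grind

/-- The resonance identity of the Airy phase. -/
theorem three_mul_abs_le_of_abs_modulation_le {ξ τ ξ₁ τ₁ S : ℝ} (h : |τ - ξ ^ 3| ≤ S)
    (h₁ : |τ₁ - ξ₁ ^ 3| ≤ S) (h₂ : |τ - τ₁ - (ξ - ξ₁) ^ 3| ≤ S) :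
    |ξ| * |ξ₁| * |ξ - ξ₁| ≤ S := by
  have h3 : 3 * (ξ * ξ₁ * (ξ - ξ₁)) =
      (τ₁ - ξ₁ ^ 3) + (τ - τ₁ - (ξ - ξ₁) ^ 3) - (τ - ξ ^ 3) := by ring
  rw [← abs_mul, ← abs_mul]
  rw [abs_le] at *
  constructor <;> linarith [h.1, h.2, h₁.1, h₁.2, h₂.1, h₂.2]

/-! ### Output region: integration over the input frequencies. -/

section Exponents

variable {ρ p : ℝ}

/-- The value $\xi^3/4$ is that of $\xi_1^3+(\xi-\xi_1)^3$ at its critical point $\xi_1=\xi/2$, so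
$|\tau-\xi^3/4|$ is the quantity produced by stationary phase. It differs from the modulation by at
most $\frac34|\xi|^3$. -/
theorem modulation_le_mul (ξ τ : ℝ) :
    1 + |τ - ξ ^ 3| ≤ (1 + |τ - ξ ^ 3 / 4|) * (1 + |ξ|) ^ 3 := by
  have h1 : |τ - ξ ^ 3| ≤ |τ - ξ ^ 3 / 4| + |ξ| ^ 3 := by
    have := abs_sub (τ - ξ ^ 3 / 4) (3 / 4 * ξ ^ 3)
    rw [show τ - ξ ^ 3 / 4 - 3 / 4 * ξ ^ 3 = τ - ξ ^ 3 by ring, abs_mul, abs_pow,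
      abs_of_pos (by norm_num : (0 : ℝ) < 3 / 4)] at this
    have := pow_nonneg (abs_nonneg ξ) 3
    linarith
  have h2 : 1 + |ξ| ^ 3 ≤ (1 + |ξ|) ^ 3 := by
    have := abs_nonneg ξ
    nlinarith [sq_nonneg |ξ|]
  calc 1 + |τ - ξ ^ 3| ≤ (1 + |τ - ξ ^ 3 / 4|) * (1 + |ξ| ^ 3) := by
        have : 0 ≤ |τ - ξ ^ 3 / 4| * |ξ| ^ 3 := by positivity
        linarith
    _ ≤ _ := by gcongr

/-- The points $\xi^3$ and $\xi^3/4$ are $\frac34|\xi|^3$ apart, so $\tau$ cannot be close to both.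
-/
theorem cube_le_modulation_mul (ξ τ : ℝ) :
    (1 + |ξ|) ^ 3 ≤ 6 * ((1 + |τ - ξ ^ 3 / 4|) * (1 + |τ - ξ ^ 3|)) := by
  have h1 : 3 / 4 * |ξ| ^ 3 ≤ |τ - ξ ^ 3 / 4| + |τ - ξ ^ 3| := by
    have := abs_sub (τ - ξ ^ 3 / 4) (τ - ξ ^ 3)
    rwa [show τ - ξ ^ 3 / 4 - (τ - ξ ^ 3) = 3 / 4 * ξ ^ 3 by ring, abs_mul, abs_pow,
      abs_of_pos (by norm_num : (0 : ℝ) < 3 / 4)] at this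
  have h2 : (1 + |ξ|) ^ 3 ≤ 4 * (1 + |ξ| ^ 3) := by
    have := abs_nonneg ξ
    nlinarith [mul_nonneg (by linarith : 0 ≤ 1 + |ξ|) (sq_nonneg (|ξ| - 1))]
  have : 0 ≤ |τ - ξ ^ 3 / 4| * |τ - ξ ^ 3| := by positivity
  linarith [abs_nonneg (τ - ξ ^ 3 / 4), abs_nonneg (τ - ξ ^ 3)]

/-- This is the exponent budget. After the resonance gain a power $2\rho-p$ of the modulation is
left over; `hθ'` bounds its cost in powers of $|\xi|$ and, with $\rho\le3/4$, forces
$2\rho-p\le1/2$, so the stationary phase denominator absorbs the rest. -/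
theorem modulation_rpow_le (hρ : ρ ≤ 3 / 4) (hθ : 0 ≤ 2 * ρ - p)
    (hθ' : 3 * (2 * ρ - p) ≤ 4 * ρ - 3 / 2) (ξ τ : ℝ) :
    (1 + |τ - ξ ^ 3|) ^ (2 * ρ - p) ≤
      √(1 + |τ - ξ ^ 3 / 4|) * (1 + |ξ|) ^ (4 * ρ - 3 / 2) := by
  have hX : 1 ≤ 1 + |ξ| := by linarith [abs_nonneg ξ]
  have hD : 1 ≤ 1 + |τ - ξ ^ 3 / 4| := by linarith [abs_nonneg (τ - ξ ^ 3 / 4)]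
  calc (1 + |τ - ξ ^ 3|) ^ (2 * ρ - p)
      ≤ ((1 + |τ - ξ ^ 3 / 4|) * (1 + |ξ|) ^ 3) ^ (2 * ρ - p) :=
        Real.rpow_le_rpow (by positivity) (modulation_le_mul ξ τ) hθ
    _ = (1 + |τ - ξ ^ 3 / 4|) ^ (2 * ρ - p) * (1 + |ξ|) ^ (3 * (2 * ρ - p)) := by
        rw [Real.mul_rpow (by positivity) (by positivity), ← Real.rpow_natCast (1 + |ξ|),
          ← Real.rpow_mul (by positivity)]
        norm_num
    _ ≤ (1 + |τ - ξ ^ 3 / 4|) ^ (1 / 2 : ℝ) * (1 + |ξ|) ^ (4 * ρ - 3 / 2) := by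
        gcongr
        linarith
    _ = _ := by rw [Real.sqrt_eq_rpow]

/-- The right side is, up to a constant, the reciprocal of the stationary phase bound with $k=3\xi$.
The summand $1$ comes from small input frequencies and is paid for by `cube_le_modulation_mul`; the
other comes from the resonance and is paid for by `modulation_rpow_le`, the powers of $1+|\xi|$
adding up to zero. -/
theorem output_weight_le (hρ : ρ ≤ 3 / 4) (hp : 1 / 2 ≤ p) (hθ : 0 ≤ 2 * ρ - p)
    (hθ' : 3 * (2 * ρ - p) ≤ 4 * ρ - 3 / 2) {ξ : ℝ} (hξ : ξ ≠ 0) (τ : ℝ) :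
    ξ ^ 2 * (1 + ((1 + |τ - ξ ^ 3|) / |ξ|) ^ (2 * ρ) * (1 + |ξ|) ^ (-(2 * ρ))) *
      (1 + |τ - ξ ^ 3|) ^ (-p) ≤ 4 * (√|ξ| * √(1 + |τ - ξ ^ 3 / 4|)) := by
  have hx : 0 < |ξ| := abs_pos.2 hξ
  set S := 1 + |τ - ξ ^ 3| with hS
  set D := 1 + |τ - ξ ^ 3 / 4| with hD
  have hS1 : 1 ≤ S := by linarith [abs_nonneg (τ - ξ ^ 3)]
  have hS0 : 0 < S := by linarith
  have hsq : ξ ^ 2 = √|ξ| * |ξ| ^ (3 / 2 : ℝ) := by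
    rw [Real.sqrt_eq_rpow, ← Real.rpow_add hx, ← sq_abs, ← Real.rpow_natCast]
    norm_num
  have h1 : |ξ| ^ (3 / 2 : ℝ) * S ^ (-p) ≤ 3 * √D := by
    calc |ξ| ^ (3 / 2 : ℝ) * S ^ (-p) ≤ (1 + |ξ|) ^ (3 / 2 : ℝ) * S ^ (-(1 / 2) : ℝ) := by
          gcongr
          linarith
      _ = √((1 + |ξ|) ^ 3) * S ^ (-(1 / 2) : ℝ) := by
          rw [Real.sqrt_eq_rpow, ← Real.rpow_natCast, ← Real.rpow_mul (by positivity)]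
          norm_num
      _ ≤ √(6 * (D * S)) * S ^ (-(1 / 2) : ℝ) := by
          gcongr
          exact cube_le_modulation_mul ξ τ
      _ = √6 * √D * (√S * S ^ (-(1 / 2) : ℝ)) := by
          rw [Real.sqrt_mul (by norm_num), Real.sqrt_mul (by positivity)]
          ring
      _ = √6 * √D := by
          rw [Real.sqrt_eq_rpow S, ← Real.rpow_add hS0]
          norm_num
      _ ≤ 3 * √D := by
          gcongr
          rw [Real.sqrt_le_left (by norm_num)]
          norm_num
  have h2 : |ξ| ^ (3 / 2 : ℝ) * ((S / |ξ|) ^ (2 * ρ) * (1 + |ξ|) ^ (-(2 * ρ))) * S ^ (-p) ≤ √D := by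
    calc |ξ| ^ (3 / 2 : ℝ) * ((S / |ξ|) ^ (2 * ρ) * (1 + |ξ|) ^ (-(2 * ρ))) * S ^ (-p)
        = |ξ| ^ (3 / 2 - 2 * ρ) * (1 + |ξ|) ^ (-(2 * ρ)) * S ^ (2 * ρ - p) := by
          rw [Real.div_rpow hS0.le hx.le, Real.rpow_sub hx, sub_eq_add_neg (2 * ρ),
            Real.rpow_add hS0]
          ring
      _ ≤ (1 + |ξ|) ^ (3 / 2 - 2 * ρ) * (1 + |ξ|) ^ (-(2 * ρ)) *
            (√D * (1 + |ξ|) ^ (4 * ρ - 3 / 2)) := by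
          gcongr
          · linarith
          · linarith
          · exact modulation_rpow_le hρ hθ hθ' ξ τ
      _ = √D * ((1 + |ξ|) ^ (3 / 2 - 2 * ρ) * (1 + |ξ|) ^ (-(2 * ρ)) *
            (1 + |ξ|) ^ (4 * ρ - 3 / 2)) := by ring
      _ = √D := by
          rw [← Real.rpow_add (by positivity), ← Real.rpow_add (by positivity)]
          ring_nf
          simp
  calc _ = √|ξ| * (|ξ| ^ (3 / 2 : ℝ) * S ^ (-p) +
        |ξ| ^ (3 / 2 : ℝ) * ((S / |ξ|) ^ (2 * ρ) * (1 + |ξ|) ^ (-(2 * ρ))) * S ^ (-p)) := by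
        rw [hsq]
        ring
    _ ≤ √|ξ| * (3 * √D + √D) := by gcongr
    _ = _ := by ring

theorem four_rpow_two_mul_le (hρ : ρ ≤ 3 / 4) : (4 : ℝ) ^ (2 * ρ) ≤ 8 := by
  calc (4 : ℝ) ^ (2 * ρ) ≤ 4 ^ (3 / 2 : ℝ) := by
        gcongr
        · norm_num
        · linarith
    _ = 8 := by
        rw [show (4 : ℝ) = 2 ^ (2 : ℝ) by norm_num, ← Real.rpow_mul (by norm_num)]
        norm_num

/-- If an input frequency is at most $1$, then $(1+|\xi_1|)(1+|\xi-\xi_1|)\le4(1+|\xi|)$ and the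
weights balance. Otherwise both exceed $1$ and the resonance bounds $|\xi_1||\xi-\xi_1|$ by the
output modulation over $|\xi|$. The $8$ is $4^{2\rho}$ at $\rho=3/4$. -/
theorem OutputRegion.kdvKernelSq_le {q ξ τ ξ₁ τ₁ : ℝ} (hξ : ξ ≠ 0) (hρ' : 1 / 2 ≤ ρ)
    (hρ : ρ ≤ 3 / 4) (h : OutputRegion ξ τ ξ₁ τ₁) :
    kdvKernelSq ρ p q ξ τ ξ₁ τ₁ ≤
      8 * (ξ ^ 2 * (1 + ((1 + |τ - ξ ^ 3|) / |ξ|) ^ (2 * ρ) * (1 + |ξ|) ^ (-(2 * ρ))) *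
        (1 + |τ - ξ ^ 3|) ^ (-p)) *
      ((1 + |τ₁ - ξ₁ ^ 3|) ^ (-q) * (1 + |τ₁ - (τ - (ξ - ξ₁) ^ 3)|) ^ (-q)) := by
  have hx : 0 < |ξ| := abs_pos.2 hξ
  have h4 := four_rpow_two_mul_le hρ
  have hpr : |ξ - ξ₁| ≤ |ξ| + |ξ₁| := abs_sub ξ ξ₁
  have hpr' : |ξ₁| ≤ |ξ| + |ξ - ξ₁| := by
    have := abs_sub ξ (ξ - ξ₁)
    rwa [sub_sub_cancel] at this
  have n0 := abs_nonneg ξ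
  have n1 := abs_nonneg ξ₁
  have n2 := abs_nonneg (ξ - ξ₁)
  have key : ((1 + |ξ₁|) * (1 + |ξ - ξ₁|)) ^ (2 * ρ) * (1 + |ξ|) ^ (-(2 * ρ)) ≤
      8 * (1 + ((1 + |τ - ξ ^ 3|) / |ξ|) ^ (2 * ρ) * (1 + |ξ|) ^ (-(2 * ρ))) := by
    by_cases hlow : |ξ₁| ≤ 1 ∨ |ξ - ξ₁| ≤ 1
    · have h1 : (1 + |ξ₁|) * (1 + |ξ - ξ₁|) ≤ 4 * (1 + |ξ|) := by
        rcases hlow with hl | hl <;> nlinarith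
      calc ((1 + |ξ₁|) * (1 + |ξ - ξ₁|)) ^ (2 * ρ) * (1 + |ξ|) ^ (-(2 * ρ))
          ≤ (4 * (1 + |ξ|)) ^ (2 * ρ) * (1 + |ξ|) ^ (-(2 * ρ)) := by gcongr
        _ = 4 ^ (2 * ρ) := by
            rw [Real.mul_rpow (by norm_num) (by positivity), mul_assoc,
              ← Real.rpow_add (by positivity), add_neg_cancel, Real.rpow_zero, mul_one]
        _ ≤ 8 * (1 + 0) := by linarith
        _ ≤ _ := by
            gcongr
            positivity
    · have hm := h.resolve_left hlow
      push Not at hlow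
      have hr := three_mul_abs_le_of_abs_modulation_le le_rfl hm.1 hm.2
      have h1 : (1 + |ξ₁|) * (1 + |ξ - ξ₁|) ≤ 4 * ((1 + |τ - ξ ^ 3|) / |ξ|) := by
        have h2 : |ξ₁| * |ξ - ξ₁| ≤ (1 + |τ - ξ ^ 3|) / |ξ| := by
          rw [le_div_iff₀ hx]
          linarith
        nlinarith
      calc ((1 + |ξ₁|) * (1 + |ξ - ξ₁|)) ^ (2 * ρ) * (1 + |ξ|) ^ (-(2 * ρ))
          ≤ (4 * ((1 + |τ - ξ ^ 3|) / |ξ|)) ^ (2 * ρ) * (1 + |ξ|) ^ (-(2 * ρ)) := by gcongr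
        _ = 4 ^ (2 * ρ) * (((1 + |τ - ξ ^ 3|) / |ξ|) ^ (2 * ρ) * (1 + |ξ|) ^ (-(2 * ρ))) := by
            rw [Real.mul_rpow (by norm_num) (by positivity), mul_assoc]
        _ ≤ 8 * (1 + ((1 + |τ - ξ ^ 3|) / |ξ|) ^ (2 * ρ) * (1 + |ξ|) ^ (-(2 * ρ))) := by
            gcongr
            linarith
  unfold kdvKernelSq
  rw [show τ₁ - (τ - (ξ - ξ₁) ^ 3) = -(τ - τ₁ - (ξ - ξ₁) ^ 3) by ring, abs_neg]
  calc _ = ξ ^ 2 * (((1 + |ξ₁|) * (1 + |ξ - ξ₁|)) ^ (2 * ρ) * (1 + |ξ|) ^ (-(2 * ρ))) *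
        (1 + |τ - ξ ^ 3|) ^ (-p) *
        ((1 + |τ₁ - ξ₁ ^ 3|) ^ (-q) * (1 + |τ - τ₁ - (ξ - ξ₁) ^ 3|) ^ (-q)) := by ring
    _ ≤ ξ ^ 2 * (8 * (1 + ((1 + |τ - ξ ^ 3|) / |ξ|) ^ (2 * ρ) * (1 + |ξ|) ^ (-(2 * ρ)))) *
        (1 + |τ - ξ ^ 3|) ^ (-p) *
        ((1 + |τ₁ - ξ₁ ^ 3|) ^ (-q) * (1 + |τ - τ₁ - (ξ - ξ₁) ^ 3|) ^ (-q)) := by gcongr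
    _ = _ := by ring

open Classical in
/-- The kernel is square integrable over the input frequencies on the output region. -/
theorem exists_lintegral_outputRegion_le {q : ℝ} (hρ : ρ ≤ 3 / 4) (hp : 1 / 2 ≤ p)
    (hρ' : 1 / 2 ≤ ρ) (hθ : 0 ≤ 2 * ρ - p) (hθ' : 3 * (2 * ρ - p) ≤ 4 * ρ - 3 / 2) (hq : 1 < q) :
    ∃ C : ℝ, 0 < C ∧ ∀ ξ τ : ℝ,
      ∫⁻ ξ₁ : ℝ, ∫⁻ τ₁ : ℝ, (if OutputRegion ξ τ ξ₁ τ₁ then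
        ENNReal.ofReal (kdvKernelSq ρ p q ξ τ ξ₁ τ₁) else 0) ≤ ENNReal.ofReal C := by
  obtain ⟨C₁, hC₁, h₁⟩ := exists_lintegral_bracket_mul_bracket_le (p := q) (by linarith) le_rfl hq
  obtain ⟨C₂, hC₂, h₂⟩ := exists_lintegral_quadratic_le hq
  refine ⟨32 * C₁ * C₂, by positivity, fun ξ τ => ?_⟩
  by_cases hξ : ξ = 0
  · simp [hξ, kdvKernelSq]
  have hx : 0 < |ξ| := abs_pos.2 hξ
  set W := ξ ^ 2 * (1 + ((1 + |τ - ξ ^ 3|) / |ξ|) ^ (2 * ρ) * (1 + |ξ|) ^ (-(2 * ρ))) *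
        (1 + |τ - ξ ^ 3|) ^ (-p) with hW
  have hW0 : 0 ≤ W := by positivity
  have hWle : W ≤ 4 * (√|ξ| * √(1 + |τ - ξ ^ 3 / 4|)) :=
    output_weight_le hρ hp hθ hθ' hξ τ
  calc _ ≤ ∫⁻ ξ₁ : ℝ, ∫⁻ τ₁ : ℝ, ENNReal.ofReal (8 * W) *
        ENNReal.ofReal ((1 + |τ₁ - ξ₁ ^ 3|) ^ (-q) *
          (1 + |τ₁ - (τ - (ξ - ξ₁) ^ 3)|) ^ (-q)) := by
        refine lintegral_mono fun ξ₁ => lintegral_mono fun τ₁ => ?_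
        dsimp only
        split_ifs with h
        · rw [← ENNReal.ofReal_mul (by positivity)]
          exact ENNReal.ofReal_le_ofReal (h.kdvKernelSq_le hξ hρ' hρ)
        · exact zero_le
    -- The $\tau_1$-integral leaves a bracket of $\tau-\xi_1^3-(\xi-\xi_1)^3$. The cubic terms in
    -- $\xi_1$ cancel, and completing the square at $\xi_1=\xi/2$ gives a quadratic phase.
    _ ≤ ∫⁻ ξ₁ : ℝ, ENNReal.ofReal (8 * W * C₁) *
          ENNReal.ofReal ((1 + |τ - ξ ^ 3 / 4 - (3 * ξ) * (ξ₁ - ξ / 2) ^ 2|) ^ (-q)) := by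
        refine lintegral_mono fun ξ₁ => ?_
        dsimp only
        rw [lintegral_const_mul _ (by fun_prop), ENNReal.ofReal_mul (q := C₁) (by positivity),
          mul_assoc]
        refine mul_le_mul' le_rfl ((h₁ _ _).trans_eq ?_)
        rw [ENNReal.ofReal_mul hC₁.le, show ξ₁ ^ 3 - (τ - (ξ - ξ₁) ^ 3) =
          -(τ - ξ ^ 3 / 4 - (3 * ξ) * (ξ₁ - ξ / 2) ^ 2) by ring, abs_neg]
    _ = ENNReal.ofReal (8 * W * C₁) * ∫⁻ y : ℝ,
          ENNReal.ofReal ((1 + |τ - ξ ^ 3 / 4 - (3 * ξ) * y ^ 2|) ^ (-q)) := by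
        rw [lintegral_const_mul _ (by fun_prop), lintegral_sub_right_eq_self (fun y : ℝ =>
          ENNReal.ofReal ((1 + |τ - ξ ^ 3 / 4 - (3 * ξ) * y ^ 2|) ^ (-q)))]
    _ ≤ ENNReal.ofReal (8 * W * C₁) *
          ENNReal.ofReal (C₂ / (√|3 * ξ| * √(1 + |τ - ξ ^ 3 / 4|))) := by
        gcongr
        exact h₂ _ (by simpa using hξ) _
    _ ≤ ENNReal.ofReal (32 * C₁ * C₂) := by
        rw [← ENNReal.ofReal_mul (by positivity)]
        refine ENNReal.ofReal_le_ofReal ?_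
        have hD : 0 < √(1 + |τ - ξ ^ 3 / 4|) := Real.sqrt_pos.2 (by positivity)
        have h3 : √|ξ| ≤ √|3 * ξ| := by
          apply Real.sqrt_le_sqrt
          rw [abs_mul, abs_of_pos (by norm_num : (0 : ℝ) < 3)]
          linarith
        have h3' : 0 < √|ξ| := Real.sqrt_pos.2 hx
        have h3'' : 0 < √|3 * ξ| := h3'.trans_le h3
        rw [← mul_div_assoc, div_le_iff₀ (by positivity)]
        calc 8 * W * C₁ * C₂ ≤ 8 * (4 * (√|3 * ξ| * √(1 + |τ - ξ ^ 3 / 4|))) * C₁ * C₂ := by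
              gcongr
              refine hWle.trans ?_
              gcongr
          _ = _ := by ring

end Exponents

/-! ### Input region: integration over the output frequencies. -/

section Exponents

variable {ρ p : ℝ}

theorem InputRegion.kdvKernelSq_le {q ξ τ ξ₁ τ₁ : ℝ} (hρ' : 1 / 2 ≤ ρ)
    (hρ : ρ ≤ 3 / 4) (h : InputRegion ξ τ ξ₁ τ₁) :
    kdvKernelSq ρ p q ξ τ ξ₁ τ₁ ≤
      8 * (ξ ^ 2 * (|ξ₁| * |ξ - ξ₁|) ^ (2 * ρ) * (1 + |ξ|) ^ (-(2 * ρ)) *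
        (1 + |τ₁ - ξ₁ ^ 3|) ^ (-q)) *
      ((1 + |τ - ξ ^ 3|) ^ (-p) * (1 + |τ - (τ₁ + (ξ - ξ₁) ^ 3)|) ^ (-q)) := by
  have key : ((1 + |ξ₁|) * (1 + |ξ - ξ₁|)) ^ (2 * ρ) ≤ 8 * (|ξ₁| * |ξ - ξ₁|) ^ (2 * ρ) := by
    have h1 : (1 + |ξ₁|) * (1 + |ξ - ξ₁|) ≤ 4 * (|ξ₁| * |ξ - ξ₁|) := by
      nlinarith [h.1.1, h.1.2]
    calc ((1 + |ξ₁|) * (1 + |ξ - ξ₁|)) ^ (2 * ρ) ≤ (4 * (|ξ₁| * |ξ - ξ₁|)) ^ (2 * ρ) := by gcongr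
      _ = 4 ^ (2 * ρ) * (|ξ₁| * |ξ - ξ₁|) ^ (2 * ρ) :=
          Real.mul_rpow (by norm_num) (by positivity)
      _ ≤ _ := by
          gcongr
          exact four_rpow_two_mul_le hρ
  unfold kdvKernelSq
  rw [← sub_sub τ τ₁]
  calc _ ≤ ξ ^ 2 * (1 + |ξ|) ^ (-(2 * ρ)) * (8 * (|ξ₁| * |ξ - ξ₁|) ^ (2 * ρ)) *
        (1 + |τ - ξ ^ 3|) ^ (-p) *
        ((1 + |τ₁ - ξ₁ ^ 3|) ^ (-q) * (1 + |τ - τ₁ - (ξ - ξ₁) ^ 3|) ^ (-q)) := by gcongr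
    _ = _ := by ring

/-- Groups the frequencies into the resonant product $|\xi\xi_1(\xi-\xi_1)|$. What remains is a
power of $1+|\xi|$, nonpositive once $\rho\ge1/2$. -/
theorem frequency_weight_le (hρ : ρ ≤ 3 / 4) (ξ ξ₁ : ℝ) :
    ξ ^ 2 * (|ξ₁| * |ξ - ξ₁|) ^ (2 * ρ) * (1 + |ξ|) ^ (-(2 * ρ)) ≤
      (1 + |ξ|) ^ (2 - 4 * ρ) * (|ξ| * |ξ₁| * |ξ - ξ₁|) ^ (2 * ρ) := by
  rcases eq_or_ne ξ 0 with rfl | hξ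
  · simp only [ne_eq, OfNat.ofNat_ne_zero, not_false_eq_true, zero_pow, zero_mul]
    positivity
  have hx : 0 < |ξ| := abs_pos.2 hξ
  have h1 : ξ ^ 2 = |ξ| ^ (2 - 2 * ρ) * |ξ| ^ (2 * ρ) := by
    rw [← Real.rpow_add hx, ← sq_abs, ← Real.rpow_natCast]
    norm_num
  calc ξ ^ 2 * (|ξ₁| * |ξ - ξ₁|) ^ (2 * ρ) * (1 + |ξ|) ^ (-(2 * ρ))
      = |ξ| ^ (2 - 2 * ρ) * (1 + |ξ|) ^ (-(2 * ρ)) * (|ξ| * |ξ₁| * |ξ - ξ₁|) ^ (2 * ρ) := by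
        rw [h1, mul_assoc |ξ|, Real.mul_rpow hx.le (by positivity)]
        ring
    _ ≤ (1 + |ξ|) ^ (2 - 2 * ρ) * (1 + |ξ|) ^ (-(2 * ρ)) *
          (|ξ| * |ξ₁| * |ξ - ξ₁|) ^ (2 * ρ) := by
        gcongr
        · linarith
        · linarith
    _ = _ := by
        rw [← Real.rpow_add (by positivity)]
        ring_nf

/-- Here $|\xi|$ is small against $|\xi_1|$, so the resonant product is bounded both by $S$ and by
$|\xi_1|^3$. Using the minimum of the two leaves $|\xi_1|^{3(2\rho-p)}$, and this exponent is at
most $3/2$. The bound $|\xi_1|^2$ matches the nonstationary estimate, since $\xi$ is far from the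
vertex $\xi_1/2$. -/
theorem input_weight_near_le (hρ : ρ ≤ 3 / 4) (hρ' : 1 / 2 ≤ ρ) (hp : 0 ≤ p)
    (hθ : 0 ≤ 2 * ρ - p) (hθ' : 3 * (2 * ρ - p) ≤ 4 * ρ - 3 / 2) {ξ ξ₁ S : ℝ}
    (h₁ : 1 ≤ |ξ₁|) (hS : 1 ≤ S) (h : |ξ| * |ξ₁| * |ξ - ξ₁| ≤ S) (hn : 4 * |ξ| ≤ |ξ₁|) :
    ξ ^ 2 * (|ξ₁| * |ξ - ξ₁|) ^ (2 * ρ) * (1 + |ξ|) ^ (-(2 * ρ)) * S ^ (-p) ≤ |ξ₁| ^ 2 := by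
  have hx := abs_nonneg ξ
  have h0 : 0 < |ξ₁| := by linarith
  have hc : |ξ| * |ξ₁| * |ξ - ξ₁| ≤ |ξ₁| ^ 3 := by
    have h2 : |ξ - ξ₁| ≤ 2 * |ξ₁| := (abs_sub _ _).trans (by linarith)
    calc |ξ| * |ξ₁| * |ξ - ξ₁| ≤ (|ξ₁| / 4) * |ξ₁| * (2 * |ξ₁|) := by
          gcongr
          linarith
      _ ≤ |ξ₁| ^ 3 := by nlinarith [pow_pos h0 3]
  have h3 : (1 : ℝ) ≤ |ξ₁| ^ 3 := one_le_pow₀ h₁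
  have hm : 1 ≤ min S (|ξ₁| ^ 3) := le_min hS h3
  have hm0 : 0 < min S (|ξ₁| ^ 3) := by linarith
  calc ξ ^ 2 * (|ξ₁| * |ξ - ξ₁|) ^ (2 * ρ) * (1 + |ξ|) ^ (-(2 * ρ)) * S ^ (-p)
      ≤ ((1 + |ξ|) ^ (2 - 4 * ρ) * (|ξ| * |ξ₁| * |ξ - ξ₁|) ^ (2 * ρ)) * S ^ (-p) := by
        exact mul_le_mul_of_nonneg_right (frequency_weight_le hρ ξ ξ₁) (by positivity)
    _ ≤ (1 * (min S (|ξ₁| ^ 3)) ^ (2 * ρ)) * (min S (|ξ₁| ^ 3)) ^ (-p) := by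
        have h5 : (1 + |ξ|) ^ (2 - 4 * ρ) ≤ 1 :=
          Real.rpow_le_one_of_one_le_of_nonpos (by linarith) (by linarith)
        have h6 : S ^ (-p) ≤ (min S (|ξ₁| ^ 3)) ^ (-p) :=
          bracket_rpow_neg_le hm0 (min_le_left _ _) hp
        have h7 : |ξ| * |ξ₁| * |ξ - ξ₁| ≤ min S (|ξ₁| ^ 3) := le_min h hc
        gcongr
    _ = (min S (|ξ₁| ^ 3)) ^ (2 * ρ - p) := by
        rw [one_mul, ← Real.rpow_add hm0, sub_eq_add_neg]
    _ ≤ (|ξ₁| ^ 3) ^ (2 * ρ - p) := Real.rpow_le_rpow hm0.le (min_le_right _ _) hθ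
    _ = |ξ₁| ^ (3 * (2 * ρ - p)) := by
        rw [← Real.rpow_natCast, ← Real.rpow_mul h0.le]
        norm_num
    _ ≤ |ξ₁| ^ (2 : ℝ) := Real.rpow_le_rpow_of_exponent_le h₁ (by linarith)
    _ = |ξ₁| ^ 2 := Real.rpow_two _

/-- Now the vertex $\xi=\xi_1/2$ is allowed, so the target is the reciprocal of the stationary phase
bound with $k=3\xi_1$. As $|\xi|\gtrsim|\xi_1|$, the power $(1+|\xi|)^{2-4\rho}$ becomes a gain in
$1+|\xi_1|$; combined with `modulation_rpow_le` it leaves exactly $(1+|\xi_1|)^{1/2}$. -/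
theorem input_weight_far_le (hρ : ρ ≤ 3 / 4) (hρ' : 1 / 2 ≤ ρ)
    (hθ : 0 ≤ 2 * ρ - p) (hθ' : 3 * (2 * ρ - p) ≤ 4 * ρ - 3 / 2) {ξ ξ₁ τ₁ : ℝ}
    (h₁ : 1 ≤ |ξ₁|) (h : |ξ| * |ξ₁| * |ξ - ξ₁| ≤ |τ₁ - ξ₁ ^ 3|) (hn : |ξ₁| ≤ 4 * |ξ|) :
    ξ ^ 2 * (|ξ₁| * |ξ - ξ₁|) ^ (2 * ρ) * (1 + |ξ|) ^ (-(2 * ρ)) *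
      (1 + |τ₁ - ξ₁ ^ 3|) ^ (-p) ≤ 8 * (√|ξ₁| * √(1 + |τ₁ - ξ₁ ^ 3 / 4|)) := by
  have h4 : (4 : ℝ) ^ (4 * ρ - 2) ≤ 4 := by
    calc (4 : ℝ) ^ (4 * ρ - 2) ≤ 4 ^ (1 : ℝ) := by
          gcongr
          · norm_num
          · linarith
      _ = 4 := Real.rpow_one 4
  have hS : 0 < 1 + |τ₁ - ξ₁ ^ 3| := by positivity
  have hX : 0 < 1 + |ξ₁| := by positivity
  have h2 : √(1 + |ξ₁|) ≤ 2 * √|ξ₁| := by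
    rw [Real.sqrt_le_left (by positivity), mul_pow, Real.sq_sqrt (abs_nonneg _)]
    linarith
  calc _ ≤ ((1 + |ξ|) ^ (2 - 4 * ρ) * (|ξ| * |ξ₁| * |ξ - ξ₁|) ^ (2 * ρ)) *
          (1 + |τ₁ - ξ₁ ^ 3|) ^ (-p) := by
        exact mul_le_mul_of_nonneg_right (frequency_weight_le hρ ξ ξ₁) (by positivity)
    _ ≤ (((1 + |ξ₁|) / 4) ^ (-(4 * ρ - 2)) * (1 + |τ₁ - ξ₁ ^ 3|) ^ (2 * ρ)) *
          (1 + |τ₁ - ξ₁ ^ 3|) ^ (-p) := by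
        have : (1 + |ξ|) ^ (2 - 4 * ρ) ≤ ((1 + |ξ₁|) / 4) ^ (-(4 * ρ - 2)) := by
          rw [← neg_sub]
          exact bracket_rpow_neg_le (by positivity) (by linarith) (by linarith)
        gcongr
        linarith
    _ = 4 ^ (4 * ρ - 2) * (1 + |ξ₁|) ^ (-(4 * ρ - 2)) * (1 + |τ₁ - ξ₁ ^ 3|) ^ (2 * ρ - p) := by
        rw [div_rpow_neg_eq (by positivity) (by norm_num), mul_assoc, ← Real.rpow_add hS,
          sub_eq_add_neg (2 * ρ)]
    _ ≤ 4 * (1 + |ξ₁|) ^ (-(4 * ρ - 2)) *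
          (√(1 + |τ₁ - ξ₁ ^ 3 / 4|) * (1 + |ξ₁|) ^ (4 * ρ - 3 / 2)) := by
        gcongr
        exact modulation_rpow_le hρ hθ hθ' ξ₁ τ₁
    _ = 4 * √(1 + |τ₁ - ξ₁ ^ 3 / 4|) *
          ((1 + |ξ₁|) ^ (-(4 * ρ - 2)) * (1 + |ξ₁|) ^ (4 * ρ - 3 / 2)) := by ring
    _ = 4 * √(1 + |τ₁ - ξ₁ ^ 3 / 4|) * √(1 + |ξ₁|) := by
        rw [← Real.rpow_add hX, Real.sqrt_eq_rpow (1 + |ξ₁|)]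
        ring_nf
    _ ≤ 4 * √(1 + |τ₁ - ξ₁ ^ 3 / 4|) * (2 * √|ξ₁|) := by gcongr
    _ = _ := by ring

-- The $\tau$-integral yields a bracket only to the power $-p$, which need not be integrable in
-- $\xi$. Since the resonance makes that bracket $M$ at most five times the dominant modulation $S$,
-- the missing decay $M^{-(q-p)}$ is borrowed from $S^{-q}$, which drops to $S^{-p}$.
open Classical in
theorem exists_lintegral_time_inputRegion_le {q : ℝ} (hρ : ρ ≤ 3 / 4) (hp : 0 ≤ p)
    (hρ' : 1 / 2 ≤ ρ) (hpq : p ≤ q) (hq : 1 < q) :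
    ∃ C : ℝ, 0 < C ∧ ∀ ξ ξ₁ τ₁ : ℝ,
      ∫⁻ τ : ℝ, (if InputRegion ξ τ ξ₁ τ₁ then
        ENNReal.ofReal (kdvKernelSq ρ p q ξ τ ξ₁ τ₁) else 0) ≤
      if 1 ≤ |ξ₁| ∧ |ξ| * |ξ₁| * |ξ - ξ₁| ≤ |τ₁ - ξ₁ ^ 3| then
        ENNReal.ofReal (C * (ξ ^ 2 * (|ξ₁| * |ξ - ξ₁|) ^ (2 * ρ) * (1 + |ξ|) ^ (-(2 * ρ)) *
          (1 + |τ₁ - ξ₁ ^ 3|) ^ (-p)) *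
          (1 + |τ₁ - ξ₁ ^ 3 / 4 - (3 * ξ₁) * (ξ - ξ₁ / 2) ^ 2|) ^ (-q)) else 0 := by
  obtain ⟨C, hC, h⟩ := exists_lintegral_bracket_mul_bracket_le hp hpq hq
  refine ⟨8 * C * 5 ^ (q - p), by positivity, fun ξ ξ₁ τ₁ => ?_⟩
  split_ifs with hr
  · set W := ξ ^ 2 * (|ξ₁| * |ξ - ξ₁|) ^ (2 * ρ) * (1 + |ξ|) ^ (-(2 * ρ)) with hW
    set S := 1 + |τ₁ - ξ₁ ^ 3| with hS
    set M := 1 + |τ₁ - ξ₁ ^ 3 / 4 - (3 * ξ₁) * (ξ - ξ₁ / 2) ^ 2| with hM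
    have hS0 : 0 < S := by positivity
    have hM0 : 0 < M := by positivity
    have hMS : M ≤ 5 * S := by
      have h1 := abs_sub (τ₁ - ξ₁ ^ 3) (3 * (ξ * ξ₁ * (ξ - ξ₁)))
      rw [show τ₁ - ξ₁ ^ 3 - 3 * (ξ * ξ₁ * (ξ - ξ₁)) =
        τ₁ - ξ₁ ^ 3 / 4 - (3 * ξ₁) * (ξ - ξ₁ / 2) ^ 2 by ring, abs_mul, abs_mul, abs_mul,
        abs_of_pos (by norm_num : (0 : ℝ) < 3)] at h1
      have := abs_nonneg (τ₁ - ξ₁ ^ 3)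
      linarith [hr.2]
    have hMp : M ^ (-p) ≤ 5 ^ (q - p) * S ^ (q - p) * M ^ (-q) := by
      calc M ^ (-p) = M ^ (q - p) * M ^ (-q) := by
            rw [← Real.rpow_add hM0]
            ring_nf
        _ ≤ (5 * S) ^ (q - p) * M ^ (-q) := by
            gcongr
        _ = _ := by rw [Real.mul_rpow (by norm_num) hS0.le]
    calc ∫⁻ τ : ℝ, (if InputRegion ξ τ ξ₁ τ₁ then
          ENNReal.ofReal (kdvKernelSq ρ p q ξ τ ξ₁ τ₁) else 0)
        ≤ ∫⁻ τ : ℝ, ENNReal.ofReal (8 * (W * S ^ (-q))) * ENNReal.ofReal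
            ((1 + |τ - ξ ^ 3|) ^ (-p) * (1 + |τ - (τ₁ + (ξ - ξ₁) ^ 3)|) ^ (-q)) := by
          refine lintegral_mono fun τ => ?_
          dsimp only
          split_ifs with hi
          · rw [← ENNReal.ofReal_mul (by positivity)]
            exact ENNReal.ofReal_le_ofReal (hi.kdvKernelSq_le hρ' hρ)
          · exact zero_le
      _ = ENNReal.ofReal (8 * (W * S ^ (-q))) * ∫⁻ τ : ℝ, ENNReal.ofReal
            ((1 + |τ - ξ ^ 3|) ^ (-p) * (1 + |τ - (τ₁ + (ξ - ξ₁) ^ 3)|) ^ (-q)) :=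
          lintegral_const_mul _ (by fun_prop)
      _ ≤ ENNReal.ofReal (8 * (W * S ^ (-q))) * ENNReal.ofReal (C * M ^ (-p)) := by
          refine mul_le_mul' le_rfl ((h _ _).trans_eq ?_)
          rw [hM, show ξ ^ 3 - (τ₁ + (ξ - ξ₁) ^ 3) =
            -(τ₁ - ξ₁ ^ 3 / 4 - (3 * ξ₁) * (ξ - ξ₁ / 2) ^ 2) by ring, abs_neg]
      _ ≤ _ := by
          rw [← ENNReal.ofReal_mul (by positivity)]
          refine ENNReal.ofReal_le_ofReal ?_
          calc 8 * (W * S ^ (-q)) * (C * M ^ (-p))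
              ≤ 8 * (W * S ^ (-q)) * (C * (5 ^ (q - p) * S ^ (q - p) * M ^ (-q))) := by gcongr
            _ = 8 * C * 5 ^ (q - p) * (W * (S ^ (-q) * S ^ (q - p))) * M ^ (-q) := by ring
            _ = _ := by
                rw [← Real.rpow_add hS0]
                ring_nf
  · refine le_of_eq ((lintegral_congr fun τ => if_neg fun hi => hr ⟨hi.1.1, ?_⟩).trans
      lintegral_zero)
    exact three_mul_abs_le_of_abs_modulation_le hi.2.1 le_rfl hi.2.2

open Classical in
/-- The kernel is square integrable over the output frequencies on the input region. -/
theorem exists_lintegral_inputRegion_le {q : ℝ} (hρ : ρ ≤ 3 / 4) (hp : 0 ≤ p)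
    (hρ' : 1 / 2 ≤ ρ) (hθ : 0 ≤ 2 * ρ - p) (hθ' : 3 * (2 * ρ - p) ≤ 4 * ρ - 3 / 2)
    (hpq : p ≤ q) (hq : 1 < q) :
    ∃ C : ℝ, 0 < C ∧ ∀ ξ₁ τ₁ : ℝ,
      ∫⁻ ξ : ℝ, ∫⁻ τ : ℝ, (if InputRegion ξ τ ξ₁ τ₁ then
        ENNReal.ofReal (kdvKernelSq ρ p q ξ τ ξ₁ τ₁) else 0) ≤ ENNReal.ofReal C := by
  obtain ⟨C₁, hC₁, h₁⟩ := exists_lintegral_time_inputRegion_le (ρ := ρ) (p := p) hρ hp hρ' hpq hq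
  obtain ⟨C₂, hC₂, h₂⟩ := exists_lintegral_quadratic_le hq
  obtain ⟨C₃, hC₃, h₃⟩ := exists_setLIntegral_quadratic_le hq
  refine ⟨C₁ * (4 * C₃) + C₁ * (8 * C₂), by positivity, fun ξ₁ τ₁ => ?_⟩
  by_cases hξ₁ : 1 ≤ |ξ₁|
  swap
  · refine (lintegral_mono fun ξ => (h₁ ξ ξ₁ τ₁).trans_eq (if_neg fun h => hξ₁ h.1)).trans ?_
    simp
  have hx : 0 < |ξ₁| := by linarith
  have hx' : ξ₁ ≠ 0 := abs_pos.1 hx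
  set D := √(1 + |τ₁ - ξ₁ ^ 3 / 4|) with hD
  have hD0 : 0 < D := Real.sqrt_pos.2 (by positivity)
  let E : Set ℝ := {y | |ξ₁| / 4 ≤ |y|}
  have hE : MeasurableSet E := measurableSet_le measurable_const (by fun_prop)
  let g : ℝ → ℝ≥0∞ := fun y =>
    ENNReal.ofReal ((1 + |τ₁ - ξ₁ ^ 3 / 4 - (3 * ξ₁) * y ^ 2|) ^ (-q))
  have hg : Measurable g := by fun_prop
  have h3x : |ξ₁| ≤ |3 * ξ₁| := by
    rw [abs_mul, abs_of_pos (by norm_num : (0 : ℝ) < 3)]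
    linarith
  calc ∫⁻ ξ : ℝ, ∫⁻ τ : ℝ, (if InputRegion ξ τ ξ₁ τ₁ then
        ENNReal.ofReal (kdvKernelSq ρ p q ξ τ ξ₁ τ₁) else 0)
      ≤ ∫⁻ ξ : ℝ, (ENNReal.ofReal (C₁ * |ξ₁| ^ 2) * E.indicator g (ξ - ξ₁ / 2) +
          ENNReal.ofReal (C₁ * (8 * (√|ξ₁| * D))) * g (ξ - ξ₁ / 2)) := by
        refine lintegral_mono fun ξ => (h₁ ξ ξ₁ τ₁).trans ?_
        split_ifs with hr
        swap
        · exact zero_le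
        -- For $4|\xi|\le|\xi_1|$ the distance from $\xi$ to the vertex $\xi_1/2$ is at least
        -- $|\xi_1|/4$, which is what `E` records.
        rcases le_total (4 * |ξ|) |ξ₁| with hn | hn
        · have hmem : ξ - ξ₁ / 2 ∈ E := by
            have := abs_sub ξ (ξ - ξ₁ / 2)
            rw [sub_sub_cancel, abs_div, abs_of_pos (by norm_num : (0 : ℝ) < 2)] at this
            change |ξ₁| / 4 ≤ |ξ - ξ₁ / 2|
            linarith
          refine le_add_right ?_
          rw [Set.indicator_of_mem hmem, ← ENNReal.ofReal_mul (by positivity)]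
          refine ENNReal.ofReal_le_ofReal ?_
          have hw := input_weight_near_le hρ hρ' hp hθ hθ' hξ₁
            (S := 1 + |τ₁ - ξ₁ ^ 3|) (by linarith [abs_nonneg (τ₁ - ξ₁ ^ 3)])
            (by linarith [hr.2]) hn
          exact mul_le_mul_of_nonneg_right (mul_le_mul_of_nonneg_left hw hC₁.le) (by positivity)
        · refine le_add_left ?_
          rw [← ENNReal.ofReal_mul (by positivity)]
          refine ENNReal.ofReal_le_ofReal ?_
          exact mul_le_mul_of_nonneg_right (mul_le_mul_of_nonneg_left
            (input_weight_far_le hρ hρ' hθ hθ' hξ₁ hr.2 hn) hC₁.le) (by positivity)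
    _ = ENNReal.ofReal (C₁ * |ξ₁| ^ 2) * (∫⁻ y in E, g y) +
          ENNReal.ofReal (C₁ * (8 * (√|ξ₁| * D))) * ∫⁻ y, g y := by
        have hgE : Measurable fun ξ => E.indicator g (ξ - ξ₁ / 2) :=
          (hg.indicator hE).comp (by fun_prop)
        rw [lintegral_add_right _ (by fun_prop), lintegral_const_mul _ hgE,
          lintegral_const_mul _ (by fun_prop), lintegral_sub_right_eq_self g, lintegral_sub_right_eq_self (E.indicator g),
          lintegral_indicator hE]
    _ ≤ ENNReal.ofReal (C₁ * |ξ₁| ^ 2) * ENNReal.ofReal (C₃ / (|3 * ξ₁| * (|ξ₁| / 4))) +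
          ENNReal.ofReal (C₁ * (8 * (√|ξ₁| * D))) * ENNReal.ofReal (C₂ / (√|3 * ξ₁| * D)) := by
        gcongr
        · exact h₃ (3 * ξ₁) (by simpa using hx') _ (by positivity) _
        · exact h₂ (3 * ξ₁) (by simpa using hx') _
    _ ≤ ENNReal.ofReal (C₁ * (4 * C₃)) + ENNReal.ofReal (C₁ * (8 * C₂)) := by
        have hs : √|ξ₁| ≤ √|3 * ξ₁| := Real.sqrt_le_sqrt h3x
        have hs0 : 0 < √|ξ₁| := Real.sqrt_pos.2 hx
        have hs0' : 0 < √|3 * ξ₁| := hs0.trans_le hs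
        rw [← ENNReal.ofReal_mul (by positivity), ← ENNReal.ofReal_mul (by positivity)]
        refine add_le_add (ENNReal.ofReal_le_ofReal ?_) (ENNReal.ofReal_le_ofReal ?_)
        · rw [← mul_div_assoc, div_le_iff₀ (by positivity)]
          calc C₁ * |ξ₁| ^ 2 * C₃ = C₁ * (4 * C₃) * (|ξ₁| * (|ξ₁| / 4)) := by ring
            _ ≤ _ := by gcongr
        · rw [← mul_div_assoc, div_le_iff₀ (by positivity)]
          calc C₁ * (8 * (√|ξ₁| * D)) * C₂ = C₁ * (8 * C₂) * (√|ξ₁| * D) := by ring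
            _ ≤ _ := by gcongr
    _ = _ := by rw [← ENNReal.ofReal_add (by positivity) (by positivity)]

end Exponents

/-! ### The kernel on the plane: measurability and decomposition. -/

theorem measurableSet_outputRegion :
    MeasurableSet {z : (ℝ × ℝ) × ℝ × ℝ | OutputRegion z.1.1 z.1.2 z.2.1 z.2.2} := by
  simp only [OutputRegion, Set.ofPred_or, Set.ofPred_and]
  refine MeasurableSet.union (MeasurableSet.union ?_ ?_) (MeasurableSet.inter ?_ ?_) <;>
    exact measurableSet_le (by fun_prop) (by fun_prop)

theorem measurableSet_inputRegion :
    MeasurableSet {z : (ℝ × ℝ) × ℝ × ℝ | InputRegion z.1.1 z.1.2 z.2.1 z.2.2} := by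
  simp only [InputRegion, Set.ofPred_and]
  refine MeasurableSet.inter (MeasurableSet.inter ?_ ?_) (MeasurableSet.inter ?_ ?_) <;>
    exact measurableSet_le (by fun_prop) (by fun_prop)

theorem measurable_kdvKernelSq (ρ p q : ℝ) :
    Measurable fun z : (ℝ × ℝ) × ℝ × ℝ => kdvKernelSq ρ p q z.1.1 z.1.2 z.2.1 z.2.2 := by
  unfold kdvKernelSq
  fun_prop

/-- The kernel of the bilinear form of `∂ₓ(uv)` in Bourgain spaces. -/
noncomputable def kdvKernel (ρ p q : ℝ) (ζ η : Spacetime) : ℝ≥0∞ :=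
  ENNReal.ofReal √(kdvKernelSq ρ p q (ζ 0) (ζ 1) (η 0) (η 1))

theorem kdvKernel_sq (ρ p q : ℝ) (ζ η : Spacetime) :
    kdvKernel ρ p q ζ η ^ 2 = ENNReal.ofReal (kdvKernelSq ρ p q (ζ 0) (ζ 1) (η 0) (η 1)) := by
  rw [kdvKernel, ← ENNReal.ofReal_pow (Real.sqrt_nonneg _),
    Real.sq_sqrt (kdvKernelSq_nonneg _ _ _ _ _ _ _)]

theorem kdvKernel_symm (ρ p q : ℝ) (ζ η : Spacetime) :
    kdvKernel ρ p q ζ (ζ - η) = kdvKernel ρ p q ζ η := by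
  simp only [kdvKernel, PiLp.sub_apply, kdvKernelSq_symm]

theorem measurable_spacetime_coords :
    Measurable fun z : Spacetime × Spacetime => ((z.1 0, z.1 1), (z.2 0, z.2 1)) := by
  fun_prop

theorem measurable_kdvKernel (ρ p q : ℝ) :
    Measurable (Function.uncurry (kdvKernel ρ p q)) :=
  ((measurable_kdvKernelSq ρ p q).comp measurable_spacetime_coords).sqrt.ennreal_ofReal

open Classical in
/-- The part of the kernel in the output region. -/
noncomputable def kdvKernelOutput (ρ p q : ℝ) (ζ η : Spacetime) : ℝ≥0∞ :=
  if OutputRegion (ζ 0) (ζ 1) (η 0) (η 1) then kdvKernel ρ p q ζ η else 0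

open Classical in
/-- The part of the kernel in the input region. -/
noncomputable def kdvKernelInput (ρ p q : ℝ) (ζ η : Spacetime) : ℝ≥0∞ :=
  if InputRegion (ζ 0) (ζ 1) (η 0) (η 1) then kdvKernel ρ p q ζ η else 0

theorem measurable_kdvKernelOutput (ρ p q : ℝ) :
    Measurable (Function.uncurry (kdvKernelOutput ρ p q)) :=
  Measurable.ite (measurable_spacetime_coords measurableSet_outputRegion)
    (measurable_kdvKernel ρ p q) measurable_const

theorem measurable_kdvKernelInput (ρ p q : ℝ) :
    Measurable (Function.uncurry (kdvKernelInput ρ p q)) :=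
  Measurable.ite (measurable_spacetime_coords measurableSet_inputRegion)
    (measurable_kdvKernel ρ p q) measurable_const

theorem kdvKernel_le (ρ p q : ℝ) (ζ η : Spacetime) :
    kdvKernel ρ p q ζ η ≤ kdvKernelOutput ρ p q ζ η + kdvKernelInput ρ p q ζ η +
      kdvKernelInput ρ p q ζ (ζ - η) := by
  rcases outputRegion_or_inputRegion (ζ 0) (ζ 1) (η 0) (η 1) with h | h | h
  · simp [kdvKernelOutput, h, add_assoc]
  · rw [show kdvKernelInput ρ p q ζ η = kdvKernel ρ p q ζ η from if_pos h]
    exact (le_add_self).trans le_self_add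
  · rw [show kdvKernelInput ρ p q ζ (ζ - η) = kdvKernel ρ p q ζ η from
      (if_pos h).trans (kdvKernel_symm ρ p q ζ η)]
    exact le_add_self

theorem exists_lintegral_kdvKernelOutput_le {ρ p q : ℝ} (hρ : ρ ≤ 3 / 4) (hp : 1 / 2 ≤ p)
    (hρ' : 1 / 2 ≤ ρ) (hθ : 0 ≤ 2 * ρ - p) (hθ' : 3 * (2 * ρ - p) ≤ 4 * ρ - 3 / 2) (hq : 1 < q) :
    ∃ C : ℝ, 0 < C ∧ ∀ ζ, ∫⁻ η, kdvKernelOutput ρ p q ζ η ^ 2 ≤ ENNReal.ofReal C := by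
  classical
  obtain ⟨C, hC, h⟩ := exists_lintegral_outputRegion_le hρ hp hρ' hθ hθ' hq
  refine ⟨C, hC, fun ζ => ?_⟩
  have hm : Measurable (Function.uncurry fun ξ₁ τ₁ : ℝ =>
      if OutputRegion (ζ 0) (ζ 1) ξ₁ τ₁ then
        ENNReal.ofReal (kdvKernelSq ρ p q (ζ 0) (ζ 1) ξ₁ τ₁) else 0) := by
    have hs : MeasurableSet {z : ℝ × ℝ | OutputRegion (ζ 0) (ζ 1) z.1 z.2} :=
      measurableSet_outputRegion.preimage
        (f := fun z : ℝ × ℝ => ((ζ 0, ζ 1), z)) (by fun_prop)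
    have hk : Measurable fun z : ℝ × ℝ => kdvKernelSq ρ p q (ζ 0) (ζ 1) z.1 z.2 :=
      (measurable_kdvKernelSq ρ p q).comp (f := fun z : ℝ × ℝ => ((ζ 0, ζ 1), z)) (by fun_prop)
    exact Measurable.ite hs hk.ennreal_ofReal measurable_const
  refine le_trans (le_of_eq ?_) (h (ζ 0) (ζ 1))
  rw [← lintegral_spacetime hm]
  refine lintegral_congr fun η => ?_
  unfold kdvKernelOutput
  split_ifs
  · exact kdvKernel_sq ρ p q ζ η
  · simp

theorem exists_lintegral_kdvKernelInput_le {ρ p q : ℝ} (hρ : ρ ≤ 3 / 4) (hp : 0 ≤ p)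
    (hρ' : 1 / 2 ≤ ρ) (hθ : 0 ≤ 2 * ρ - p) (hθ' : 3 * (2 * ρ - p) ≤ 4 * ρ - 3 / 2)
    (hpq : p ≤ q) (hq : 1 < q) :
    ∃ C : ℝ, 0 < C ∧ ∀ η, ∫⁻ ζ, kdvKernelInput ρ p q ζ η ^ 2 ≤ ENNReal.ofReal C := by
  classical
  obtain ⟨C, hC, h⟩ := exists_lintegral_inputRegion_le hρ hp hρ' hθ hθ' hpq hq
  refine ⟨C, hC, fun η => ?_⟩
  have hm : Measurable (Function.uncurry fun ξ τ : ℝ =>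
      if InputRegion ξ τ (η 0) (η 1) then
        ENNReal.ofReal (kdvKernelSq ρ p q ξ τ (η 0) (η 1)) else 0) := by
    have hs : MeasurableSet {z : ℝ × ℝ | InputRegion z.1 z.2 (η 0) (η 1)} :=
      measurableSet_inputRegion.preimage
        (f := fun z : ℝ × ℝ => (z, (η 0, η 1))) (by fun_prop)
    have hk : Measurable fun z : ℝ × ℝ => kdvKernelSq ρ p q z.1 z.2 (η 0) (η 1) :=
      (measurable_kdvKernelSq ρ p q).comp (f := fun z : ℝ × ℝ => (z, (η 0, η 1))) (by fun_prop)
    exact Measurable.ite hs hk.ennreal_ofReal measurable_const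
  refine le_trans (le_of_eq ?_) (h (η 0) (η 1))
  rw [← lintegral_spacetime hm]
  refine lintegral_congr fun ζ => ?_
  unfold kdvKernelInput
  split_ifs
  · exact kdvKernel_sq ρ p q ζ η
  · simp

/-! ### The bilinear estimate in $L^2$. -/

theorem sq_add_add_le {x y z E : ℝ≥0∞} (hx : x ^ 2 ≤ E) (hy : y ^ 2 ≤ E) (hz : z ^ 2 ≤ E) :
    (x + y + z) ^ 2 ≤ 9 * E := by
  have key : ∀ m : ℝ≥0∞, m ^ 2 ≤ E → x ≤ m → y ≤ m → z ≤ m → (x + y + z) ^ 2 ≤ 9 * E := by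
    intro m hm h1 h2 h3
    calc (x + y + z) ^ 2 ≤ (m + m + m) ^ 2 := by gcongr
      _ = 9 * m ^ 2 := by ring
      _ ≤ 9 * E := by gcongr
  rcases le_total x y with h1 | h1 <;> rcases le_total y z with h2 | h2 <;>
    rcases le_total x z with h3 | h3
  · exact key z hz h3 h2 le_rfl
  · exact key z hz (h1.trans h2) h2 le_rfl
  · exact key y hy h1 le_rfl h2
  · exact key y hy h1 le_rfl h2
  · exact key z hz h3 h2 le_rfl
  · exact key x hx le_rfl h1 h3
  · exact key x hx le_rfl h1 (h2.trans h1)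
  · exact key x hx le_rfl h1 h3

section Bilinear

variable {F G : Spacetime → ℝ≥0∞}

theorem lintegral_lintegral_mul_sub_sq (hF : Measurable F) (hG : Measurable G) :
    ∫⁻ ζ, ∫⁻ η, (F η * G (ζ - η)) ^ 2 = (∫⁻ η, F η ^ 2) * ∫⁻ η, G η ^ 2 := by
  rw [lintegral_lintegral_swap (by fun_prop)]
  simp only [mul_pow]
  rw [← lintegral_mul_const _ (by fun_prop)]
  refine lintegral_congr fun η => ?_
  rw [lintegral_const_mul _ (by fun_prop), lintegral_sub_right_eq_self (fun ζ => G ζ ^ 2)]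

theorem lintegral_lintegral_mul_sub_sq' (hF : Measurable F) (hG : Measurable G) :
    ∫⁻ η, ∫⁻ ζ, (F ζ * G (ζ - η)) ^ 2 = (∫⁻ η, F η ^ 2) * ∫⁻ η, G η ^ 2 := by
  rw [lintegral_lintegral_swap (by fun_prop)]
  simp only [mul_pow]
  rw [← lintegral_mul_const _ (by fun_prop)]
  refine lintegral_congr fun η => ?_
  rw [lintegral_const_mul _ (by fun_prop), lintegral_sub_left_eq_self (fun ζ => G ζ ^ 2)]

/-- The bilinear estimate in `L²`. -/
theorem exists_lintegral_sq_kdvKernel_le {ρ p q : ℝ} (hρ : ρ ≤ 3 / 4) (hp : 1 / 2 ≤ p)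
    (hρ' : 1 / 2 ≤ ρ) (hθ : 0 ≤ 2 * ρ - p) (hθ' : 3 * (2 * ρ - p) ≤ 4 * ρ - 3 / 2)
    (hpq : p ≤ q) (hq : 1 < q) :
    ∃ C : ℝ, 0 < C ∧ ∀ F G : Spacetime → ℝ≥0∞, Measurable F → Measurable G →
      ∫⁻ ζ, (∫⁻ η, kdvKernel ρ p q ζ η * (F η * G (ζ - η))) ^ 2 ≤
        ENNReal.ofReal C * ((∫⁻ η, F η ^ 2) * ∫⁻ η, G η ^ 2) := by
  obtain ⟨C₁, hC₁, h₁⟩ := exists_lintegral_kdvKernelOutput_le hρ hp hρ' hθ hθ' hq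
  obtain ⟨C₂, hC₂, h₂⟩ :=
    exists_lintegral_kdvKernelInput_le hρ (by linarith) hρ' hθ hθ' hpq hq
  refine ⟨9 * (C₁ + C₂), by positivity, fun F G hF hG => ?_⟩
  have hk := measurable_kdvKernel ρ p q
  have hkA := measurable_kdvKernelOutput ρ p q
  have hkB := measurable_kdvKernelInput ρ p q
  have hinput : ∀ H F G : Spacetime → ℝ≥0∞, Measurable H → Measurable F → Measurable G →
      (∫⁻ ζ, H ζ * ∫⁻ η, kdvKernelInput ρ p q ζ η * (F η * G (ζ - η))) ^ 2 ≤
        ENNReal.ofReal (C₁ + C₂) * ((∫⁻ η, F η ^ 2) * ∫⁻ η, G η ^ 2) * ∫⁻ ζ, H ζ ^ 2 := by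
    intro H F G hH hF hG
    -- By Tonelli the input frequency becomes the outer variable. Then `F` takes the place of the
    -- test function and the kernel is square integrated over the output, as the input region
    -- requires.
    have hswap : ∫⁻ ζ, H ζ * ∫⁻ η, kdvKernelInput ρ p q ζ η * (F η * G (ζ - η)) =
        ∫⁻ η, F η * ∫⁻ ζ, kdvKernelInput ρ p q ζ η * (H ζ * G (ζ - η)) := by
      have h1 : ∀ ζ, H ζ * ∫⁻ η, kdvKernelInput ρ p q ζ η * (F η * G (ζ - η)) =
          ∫⁻ η, H ζ * (kdvKernelInput ρ p q ζ η * (F η * G (ζ - η))) := fun ζ =>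
        (lintegral_const_mul _ ((hkB.comp measurable_prodMk_left).mul (by fun_prop))).symm
      have h2 : ∀ η, F η * ∫⁻ ζ, kdvKernelInput ρ p q ζ η * (H ζ * G (ζ - η)) =
          ∫⁻ ζ, F η * (kdvKernelInput ρ p q ζ η * (H ζ * G (ζ - η))) := fun η =>
        (lintegral_const_mul _ ((hkB.comp measurable_prodMk_right).mul (by fun_prop))).symm
      simp only [h1, h2]
      rw [lintegral_lintegral_swap
        ((hH.comp measurable_fst).mul (hkB.mul (by fun_prop))).aemeasurable]
      refine lintegral_congr fun η => lintegral_congr fun ζ => ?_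
      ring
    rw [hswap]
    refine (sq_lintegral_kernel_le volume volume (k := fun η ζ => kdvKernelInput ρ p q ζ η)
      (Ψ := fun η ζ => H ζ * G (ζ - η)) hF (hkB.comp measurable_swap) (by
        simp only [Function.uncurry_def]; fun_prop) h₂).trans ?_
    rw [lintegral_lintegral_mul_sub_sq' hH hG]
    calc ENNReal.ofReal C₂ * (∫⁻ x, F x ^ 2) * ((∫⁻ η, H η ^ 2) * ∫⁻ η, G η ^ 2)
        = ENNReal.ofReal C₂ * ((∫⁻ x, F x ^ 2) * ∫⁻ η, G η ^ 2) * ∫⁻ η, H η ^ 2 := by ring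
      _ ≤ _ := by
        gcongr
        linarith
  refine lintegral_sq_le_of_forall_sq_lintegral_mul_le volume
    (Measurable.lintegral_prod_right' (f := fun z : Spacetime × Spacetime =>
      kdvKernel ρ p q z.1 z.2 * (F z.2 * G (z.1 - z.2))) (hk.mul (by fun_prop))) fun H hH => ?_
  have hout : (∫⁻ ζ, H ζ * ∫⁻ η, kdvKernelOutput ρ p q ζ η * (F η * G (ζ - η))) ^ 2 ≤
      ENNReal.ofReal (C₁ + C₂) * ((∫⁻ η, F η ^ 2) * ∫⁻ η, G η ^ 2) * ∫⁻ ζ, H ζ ^ 2 := by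
    refine (sq_lintegral_kernel_le volume volume (Ψ := fun ζ η => F η * G (ζ - η)) hH hkA (by
        simp only [Function.uncurry_def]; fun_prop) h₁).trans ?_
    rw [lintegral_lintegral_mul_sub_sq hF hG, mul_assoc, mul_assoc,
      mul_comm (∫⁻ x, H x ^ 2)]
    gcongr
    linarith
  have hin := hinput H F G hH hF hG
  have hin' := hinput H G F hH hG hF
  rw [mul_comm (∫⁻ η, G η ^ 2)] at hin'
  refine le_trans ?_ ((sq_add_add_le hout hin hin').trans_eq ?_)
  · gcongr
    have hmB : Measurable fun ζ => H ζ * ∫⁻ η, kdvKernelInput ρ p q ζ η * (F η * G (ζ - η)) :=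
      hH.mul (Measurable.lintegral_prod_right' (f := fun z : Spacetime × Spacetime =>
        kdvKernelInput ρ p q z.1 z.2 * (F z.2 * G (z.1 - z.2))) (hkB.mul (by fun_prop)))
    have hmA : Measurable fun ζ => H ζ * ∫⁻ η, kdvKernelOutput ρ p q ζ η * (F η * G (ζ - η)) :=
      hH.mul (Measurable.lintegral_prod_right' (f := fun z : Spacetime × Spacetime =>
        kdvKernelOutput ρ p q z.1 z.2 * (F z.2 * G (z.1 - z.2))) (hkA.mul (by fun_prop)))
    rw [← lintegral_add_left hmA, ← lintegral_add_left (by exact hmA.add hmB)]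
    refine lintegral_mono fun ζ => ?_
    dsimp only
    rw [← mul_add, ← mul_add]
    gcongr
    have hm1 : Measurable fun η => kdvKernelOutput ρ p q ζ η * (F η * G (ζ - η)) :=
      (hkA.comp measurable_prodMk_left).mul (by fun_prop)
    have hm2 : Measurable fun η => kdvKernelInput ρ p q ζ η * (F η * G (ζ - η)) :=
      (hkB.comp measurable_prodMk_left).mul (by fun_prop)
    -- The substitution $\eta\mapsto\zeta-\eta$ exchanges the two inputs, so the third piece of the
    -- kernel is the second one with `F` and `G` interchanged.
    rw [← lintegral_sub_left_eq_self (fun η => kdvKernelInput ρ p q ζ η * (G η * F (ζ - η))) ζ,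
      ← lintegral_add_left hm1, ← lintegral_add_left (by exact hm1.add hm2)]
    refine lintegral_mono fun η => ?_
    dsimp only
    rw [sub_sub_cancel, mul_comm (G (ζ - η)), ← add_mul, ← add_mul]
    gcongr
    exact kdvKernel_le ρ p q ζ η
  · rw [ENNReal.ofReal_mul (by norm_num), ENNReal.ofReal_ofNat]
    ring

end Bilinear

/-! ### Distributions whose Fourier transform is a function. -/

theorem quasiMeasurePreserving_spacetime_smul {c : ℝ} (hc : c ≠ 0) :
    Measure.QuasiMeasurePreserving (fun ζ : Spacetime => c • ζ) volume volume := by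
  refine ⟨by fun_prop, ?_⟩
  rw [Measure.map_addHaar_smul _ hc]
  exact Measure.smul_absolutelyContinuous

namespace IsSpacetimeFourier

variable {u : 𝓢'(Spacetime, ℂ)} {f g : Spacetime → ℂ}

/-- Integrability against bump functions equal to $1$ near a given point makes the rescaled `f`
locally integrable, hence measurable; undoing the dilation preserves null sets. -/
theorem aestronglyMeasurable (hf : IsSpacetimeFourier u f) :
    AEStronglyMeasurable f volume := by
  have hpi : (2 * Real.pi) ≠ 0 := by positivity
  have hloc : LocallyIntegrable (fun ζ : Spacetime => f ((2 * Real.pi) • ζ)) volume := by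
    intro x
    let β : ContDiffBump x := ⟨1, 2, one_pos, one_lt_two⟩
    have hc : HasCompactSupport (fun y => (β y : ℂ)) :=
      β.hasCompactSupport.comp_left Complex.ofReal_zero
    have hd : ContDiff ℝ (⊤ : ℕ∞) (fun y => (β y : ℂ)) :=
      Complex.ofRealCLM.contDiff.comp β.contDiff
    have hi := (hf (hc.toSchwartzMap hd)).1
    refine ⟨Metric.closedBall x 1, Metric.closedBall_mem_nhds x one_pos, ?_⟩
    refine (hi.integrableOn (s := Metric.closedBall x 1)).congr_fun (fun y hy => ?_)
      measurableSet_closedBall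
    have : β y = 1 := β.one_of_mem_closedBall hy
    simp [this]
  have h := hloc.aestronglyMeasurable.comp_quasiMeasurePreserving
    (quasiMeasurePreserving_spacetime_smul (inv_ne_zero hpi))
  refine h.congr (Filter.Eventually.of_forall fun ζ => ?_)
  simp only [Function.comp_apply, smul_inv_smul₀ hpi]

theorem congr (hf : IsSpacetimeFourier u f) (h : f =ᵐ[volume] g) : IsSpacetimeFourier u g := by
  have hpi : (2 * Real.pi) ≠ 0 := by positivity
  intro φ
  have h' : (fun ζ : Spacetime => φ ζ * f ((2 * Real.pi) • ζ)) =ᵐ[volume]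
      fun ζ : Spacetime => φ ζ * g ((2 * Real.pi) • ζ) := by
    filter_upwards [(quasiMeasurePreserving_spacetime_smul hpi).ae h] with ζ hζ
    rw [hζ]
  exact ⟨(hf φ).1.congr h', (hf φ).2.trans (integral_congr_ae h')⟩

theorem bourgainNorm_eq (hf : IsSpacetimeFourier u f) (σ s b : ℝ) :
    bourgainNorm σ s b u = eLpNorm (fun ζ => (bourgainWeight σ s b ζ : ℂ) * f ζ) 2 volume := by
  refine le_antisymm (iInf₂_le f hf) (le_iInf₂ fun g hg => le_of_eq (eLpNorm_congr_ae ?_))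
  filter_upwards [hf.ae_eq hg] with ζ hζ
  rw [hζ]

/-- Mathlib's multiplier for the derivative is $2\pi i\,\zeta_0$; evaluating $i\xi$ at
$\xi=2\pi\zeta_0$ gives the same factor. -/
theorem lineDeriv (hf : IsSpacetimeFourier u f) :
    IsSpacetimeFourier (∂_{dirX} u) (fun ζ => Complex.I * (ζ 0 : ℂ) * f ζ) := by
  have hg : (fun ζ : Spacetime => ((inner ℝ ζ dirX : ℝ) : ℂ)).HasTemperateGrowth := by
    fun_prop
  intro φ
  have h := hf (SchwartzMap.smulLeftCLM ℂ (fun ζ : Spacetime => ((inner ℝ ζ dirX : ℝ) : ℂ)) φ)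
  have heq : ∀ ζ : Spacetime, φ ζ * (Complex.I * (((2 * Real.pi) • ζ) 0 : ℂ) *
      f ((2 * Real.pi) • ζ)) = (2 * Real.pi * Complex.I) *
      (SchwartzMap.smulLeftCLM ℂ (fun ζ : Spacetime => ((inner ℝ ζ dirX : ℝ) : ℂ)) φ ζ *
        f ((2 * Real.pi) • ζ)) := by
    intro ζ
    rw [SchwartzMap.smulLeftCLM_apply_apply hg]
    simp [dirX, PiLp.inner_apply]
    ring
  simp only [heq]
  refine ⟨h.1.const_mul _, ?_⟩
  rw [integral_const_mul, ← h.2, TemperedDistribution.fourier_lineDerivOp_eq]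
  rfl

end IsSpacetimeFourier

/-- After rescaling, `f` is an $L^1$ function times a quadratic polynomial, hence tempered; `p` is
its inverse transform. -/
theorem exists_isSpacetimeFourier {f : Spacetime → ℂ}
    (hf : Integrable (fun ζ : Spacetime => ((1 + ‖ζ‖ ^ 2)⁻¹ : ℝ) * f ζ)) :
    ∃ p : 𝓢'(Spacetime, ℂ), IsSpacetimeFourier p f := by
  have hpi : (2 * Real.pi) ≠ 0 := by positivity
  have hf' := hf.comp_smul hpi
  have hm : MemLp (fun ζ : Spacetime => ((1 + ‖(2 * Real.pi) • ζ‖ ^ 2)⁻¹ : ℝ) *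
      f ((2 * Real.pi) • ζ)) 1 volume := memLp_one_iff_integrable.2 hf'
  let w : Spacetime → ℂ := fun ζ => ((1 + ‖(2 * Real.pi) • ζ‖ ^ 2 : ℝ) : ℂ)
  have hw : w.HasTemperateGrowth := by
    have h : ∀ ζ, w ζ = ((1 + (2 * Real.pi) ^ 2 * ‖ζ‖ ^ 2 : ℝ) : ℂ) := fun ζ => by
      simp only [w, norm_smul, mul_pow, Real.norm_eq_abs, sq_abs]
    rw [funext h]
    fun_prop
  let T : 𝓢'(Spacetime, ℂ) := TemperedDistribution.smulLeftCLM ℂ w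
    (Lp.toTemperedDistribution (hm.toLp _))
  refine ⟨𝓕⁻ T, fun φ => ?_⟩
  have heq : ∀ ζ : Spacetime, SchwartzMap.smulLeftCLM ℂ w φ ζ *
      (((1 + ‖(2 * Real.pi) • ζ‖ ^ 2)⁻¹ : ℝ) * f ((2 * Real.pi) • ζ)) =
      φ ζ * f ((2 * Real.pi) • ζ) := by
    intro ζ
    rw [SchwartzMap.smulLeftCLM_apply_apply hw]
    have : (1 + (‖(2 * Real.pi) • ζ‖ : ℂ) ^ 2) ≠ 0 := by
      norm_cast
      positivity
    simp only [w, smul_eq_mul]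
    push_cast
    field_simp
  constructor
  · simp only [← heq]
    refine hf'.bdd_mul (c := SchwartzMap.seminorm ℝ 0 0 (SchwartzMap.smulLeftCLM ℂ w φ)) ?_ ?_
    · exact (SchwartzMap.smulLeftCLM ℂ w φ).continuous.aestronglyMeasurable
    · exact Filter.Eventually.of_forall fun η => SchwartzMap.norm_le_seminorm ℝ _ _
  · rw [FourierTransform.fourier_fourierInv_eq]
    simp only [T, TemperedDistribution.smulLeftCLM_apply_apply, Lp.toTemperedDistribution_apply,
      smul_eq_mul]
    refine integral_congr_ae ?_
    filter_upwards [hm.coeFn_toLp] with ζ hζ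
    rw [hζ, heq]

/-! ### Local smoothing and absolute convergence of the convolution. -/

/-- The local smoothing bound for the Airy phase. -/
theorem exists_lintegral_airy_smoothing_le {q : ℝ} (hq : 1 < q) :
    ∃ C : ℝ, 0 < C ∧ ∀ τ : ℝ,
      ∫⁻ ξ : ℝ, ENNReal.ofReal ((1 + |ξ|) ^ 2 * (1 + |τ - ξ ^ 3|) ^ (-q)) ≤
        ENNReal.ofReal C := by
  obtain ⟨C, hC, h⟩ := exists_lintegral_bracket_le hq
  refine ⟨4 * 2 + 2 * C, by positivity, fun τ => ?_⟩
  -- The substitution $y=\xi^3$ has Jacobian $3\xi^2$, which dominates $(1+|\xi|)^2/2$ when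
  -- $|\xi|\ge1$; the interval $[-1,1]$ is handled trivially.
  have hcube : ∫⁻ ξ : ℝ, ENNReal.ofReal |3 * ξ ^ 2| *
      ENNReal.ofReal ((1 + 1 * |ξ ^ 3 - τ|) ^ (-q)) ≤ ENNReal.ofReal (C / 1) := by
    have hinj : Set.InjOn (fun ξ : ℝ => ξ ^ 3) Set.univ :=
      ((Odd.strictMono_pow (by decide : Odd 3)).injective).injOn
    have := lintegral_image_eq_lintegral_abs_deriv_mul MeasurableSet.univ
      (fun ξ _ => ((hasDerivAt_pow 3 ξ).hasDerivWithinAt)) hinj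
      (fun y => ENNReal.ofReal ((1 + 1 * |y - τ|) ^ (-q)))
    simp only [Nat.cast_ofNat, Nat.add_one_sub_one, Measure.restrict_univ] at this
    exact (this.symm.trans_le (setLIntegral_le_lintegral _ _)).trans (h 1 one_pos τ)
  calc ∫⁻ ξ : ℝ, ENNReal.ofReal ((1 + |ξ|) ^ 2 * (1 + |τ - ξ ^ 3|) ^ (-q))
      ≤ ∫⁻ ξ : ℝ, ((Set.Icc (-1 : ℝ) 1).indicator (fun _ => ENNReal.ofReal 4) ξ +
          ENNReal.ofReal 2 * (ENNReal.ofReal |3 * ξ ^ 2| *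
            ENNReal.ofReal ((1 + 1 * |ξ ^ 3 - τ|) ^ (-q)))) := by
        refine lintegral_mono fun ξ => ?_
        dsimp only
        rcases le_total |ξ| 1 with hx | hx
        · refine le_add_right ?_
          rw [Set.indicator_of_mem (Set.mem_Icc.2 (abs_le.1 hx))]
          refine ENNReal.ofReal_le_ofReal ?_
          have h1 : (1 + |τ - ξ ^ 3|) ^ (-q) ≤ 1 :=
            Real.rpow_le_one_of_one_le_of_nonpos (by linarith [abs_nonneg (τ - ξ ^ 3)])
              (by linarith)
          calc (1 + |ξ|) ^ 2 * (1 + |τ - ξ ^ 3|) ^ (-q) ≤ (1 + 1) ^ 2 * 1 := by gcongr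
            _ = 4 := by norm_num
        · refine le_add_left ?_
          rw [← ENNReal.ofReal_mul (by positivity), ← ENNReal.ofReal_mul (by positivity),
            one_mul, abs_sub_comm (ξ ^ 3), ← mul_assoc]
          refine ENNReal.ofReal_le_ofReal ?_
          gcongr
          rw [abs_mul, abs_pow, abs_of_pos (by norm_num : (0 : ℝ) < 3)]
          nlinarith
    _ = (∫⁻ ξ : ℝ, (Set.Icc (-1 : ℝ) 1).indicator (fun _ => ENNReal.ofReal 4) ξ) +
          ENNReal.ofReal 2 * ∫⁻ ξ : ℝ, (ENNReal.ofReal |3 * ξ ^ 2| *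
            ENNReal.ofReal ((1 + 1 * |ξ ^ 3 - τ|) ^ (-q))) := by
        rw [lintegral_add_left (measurable_const.indicator measurableSet_Icc),
          lintegral_const_mul _ (by fun_prop)]
    _ ≤ ENNReal.ofReal (4 * 2) + ENNReal.ofReal 2 * ENNReal.ofReal (C / 1) := by
        gcongr
        rw [lintegral_indicator_const measurableSet_Icc, Real.volume_Icc,
          ENNReal.ofReal_mul (by norm_num)]
        norm_num
    _ = _ := by
        rw [← ENNReal.ofReal_mul (by norm_num), div_one,
          ← ENNReal.ofReal_add (by norm_num) (by positivity)]

/-- The integral of a function on the space-time plane over the lines `τ = const`. -/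
noncomputable def timeMarginal (X : Spacetime → ℝ≥0∞) (τ : ℝ) : ℝ≥0∞ :=
  ∫⁻ ξ : ℝ, X (spacetimeEquiv.symm (ξ, τ))

theorem measurable_timeMarginal {X : Spacetime → ℝ≥0∞} (hX : Measurable X) :
    Measurable (timeMarginal X) :=
  Measurable.lintegral_prod_left' (f := fun z : ℝ × ℝ => X (spacetimeEquiv.symm z))
    (hX.comp spacetimeEquiv.symm.measurable)

theorem spacetimeEquiv_symm_coord (ζ : Spacetime) : spacetimeEquiv.symm (ζ 0, ζ 1) = ζ :=
  spacetimeEquiv.symm_apply_apply ζ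

theorem lintegral_mul_time {X : Spacetime → ℝ≥0∞} (hX : Measurable X) {c : ℝ → ℝ≥0∞}
    (hc : Measurable c) : ∫⁻ ζ : Spacetime, c (ζ 1) * X ζ = ∫⁻ τ, c τ * timeMarginal X τ := by
  have hX' := hX.comp spacetimeEquiv.symm.measurable
  have hm : Measurable (Function.uncurry fun ξ τ : ℝ => c τ * X (spacetimeEquiv.symm (ξ, τ))) :=
    (hc.comp measurable_snd).mul hX'
  have h := lintegral_spacetime hm
  simp only [spacetimeEquiv_symm_coord] at h
  rw [h, lintegral_lintegral_swap hm.aemeasurable]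
  refine lintegral_congr fun τ => ?_
  exact lintegral_const_mul _ (hX'.comp measurable_prodMk_right)

/-- The multiplier gained by a function of the Bourgain space over its local square integral. -/
noncomputable def smoothingWeight (q : ℝ) (ζ : Spacetime) : ℝ≥0∞ :=
  ENNReal.ofReal ((1 + |ζ 0|) * (1 + |ζ 1 - ζ 0 ^ 3|) ^ (-(q / 2)))

theorem measurable_smoothingWeight (q : ℝ) : Measurable (smoothingWeight q) := by
  unfold smoothingWeight
  fun_prop

/-- Cauchy-Schwarz in $\xi$ for each fixed $\tau$, the weight being controlled by local smoothing:
an embedding of weighted $L^2$ into $L^2_\tau L^1_\xi$. -/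
theorem exists_lintegral_timeMarginal_sq_le {q : ℝ} (hq : 1 < q) :
    ∃ C : ℝ, 0 < C ∧ ∀ F : Spacetime → ℝ≥0∞, Measurable F →
      ∫⁻ τ, timeMarginal (fun ζ => smoothingWeight q ζ * F ζ) τ ^ 2 ≤
        ENNReal.ofReal C * ∫⁻ ζ, F ζ ^ 2 := by
  obtain ⟨C, hC, h⟩ := exists_lintegral_airy_smoothing_le hq
  refine ⟨C, hC, fun F hF => ?_⟩
  have hF2 : ∫⁻ ζ, F ζ ^ 2 = ∫⁻ τ, timeMarginal (fun ζ => F ζ ^ 2) τ := by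
    simpa using lintegral_mul_time (hF.pow_const 2) (measurable_const (a := (1 : ℝ≥0∞)))
  rw [hF2, ← lintegral_const_mul _ (measurable_timeMarginal (hF.pow_const 2))]
  refine lintegral_mono fun τ => ?_
  have hm : Measurable fun ξ : ℝ => spacetimeEquiv.symm (ξ, τ) :=
    spacetimeEquiv.symm.measurable.comp measurable_prodMk_right
  refine (sq_lintegral_mul_le volume ((measurable_smoothingWeight q).comp hm).aemeasurable
    (hF.comp hm).aemeasurable).trans (mul_le_mul' (le_trans (le_of_eq ?_) (h τ)) le_rfl)
  refine lintegral_congr fun ξ => ?_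
  have h1 : ((1 + |τ - ξ ^ 3|) ^ (-(q / 2))) ^ 2 = (1 + |τ - ξ ^ 3|) ^ (-q) := by
    rw [← Real.rpow_natCast, ← Real.rpow_mul (by positivity)]
    congr 1
    push_cast
    ring
  rw [← h1, ← mul_pow, ENNReal.ofReal_pow (by positivity)]
  rfl

/-- The convolution of two functions of a Bourgain space is integrable against a weight in `τ`. -/
theorem exists_lintegral_convolution_le {q : ℝ} (hq : 1 < q) :
    ∃ C : ℝ, 0 < C ∧ ∀ F G : Spacetime → ℝ≥0∞, Measurable F → Measurable G →
      (∫⁻ ζ : Spacetime, ENNReal.ofReal ((1 + |ζ 1|) ^ (-2 : ℝ)) *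
        ∫⁻ η, (smoothingWeight q (ζ - η) * F (ζ - η)) * (smoothingWeight q η * G η)) ^ 2 ≤
        ENNReal.ofReal C * ((∫⁻ ζ, F ζ ^ 2) * ∫⁻ ζ, G ζ ^ 2) := by
  obtain ⟨C, hC, h⟩ := exists_lintegral_timeMarginal_sq_le hq
  obtain ⟨D, hD, hκ⟩ := exists_lintegral_bracket_le one_lt_two
  refine ⟨D * C * (D * C), by positivity, fun F G hF hG => ?_⟩
  let κ : ℝ → ℝ≥0∞ := fun τ => ENNReal.ofReal ((1 + |τ|) ^ (-1 : ℝ))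
  have hκm : Measurable κ := by fun_prop
  have hκ2 : ∀ τ, ENNReal.ofReal ((1 + |τ|) ^ (-2 : ℝ)) = κ τ ^ 2 := by
    intro τ
    rw [← ENNReal.ofReal_pow (by positivity), ← Real.rpow_natCast, ← Real.rpow_mul (by positivity)]
    norm_num
  have hκD : ∀ t, ∫⁻ τ, κ (τ + t) ^ 2 ≤ ENNReal.ofReal D := by
    intro t
    rw [lintegral_add_right_eq_self (fun τ => κ τ ^ 2)]
    simpa only [← hκ2, one_mul, sub_zero, div_one] using hκ 1 one_pos 0
  let X : Spacetime → ℝ≥0∞ := fun ζ => smoothingWeight q ζ * F ζ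
  let Y : Spacetime → ℝ≥0∞ := fun ζ => smoothingWeight q ζ * G ζ
  have hX : Measurable X := (measurable_smoothingWeight q).mul hF
  have hY : Measurable Y := (measurable_smoothingWeight q).mul hG
  have hXm := measurable_timeMarginal hX
  have hYm := measurable_timeMarginal hY
  -- Both $\xi$-integrals decouple into marginals. The weight is split as `κ` times `κ`: one factor
  -- is the kernel, square integrable in `τ` uniformly in `t`, and the other makes the remaining
  -- function of `(τ, t)` square integrable.
  have hred : ∫⁻ ζ : Spacetime, ENNReal.ofReal ((1 + |ζ 1|) ^ (-2 : ℝ)) * ∫⁻ η, X (ζ - η) * Y η =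
      ∫⁻ t, timeMarginal Y t * ∫⁻ τ, κ (τ + t) * (κ (τ + t) * timeMarginal X τ) := by
    calc ∫⁻ ζ : Spacetime, ENNReal.ofReal ((1 + |ζ 1|) ^ (-2 : ℝ)) * ∫⁻ η, X (ζ - η) * Y η
        = ∫⁻ ζ : Spacetime, ∫⁻ η, κ (ζ 1) ^ 2 * (X (ζ - η) * Y η) := by
          refine lintegral_congr fun ζ => ?_
          rw [hκ2, lintegral_const_mul _ (by fun_prop)]
      _ = ∫⁻ η, ∫⁻ ζ : Spacetime, κ (ζ 1) ^ 2 * (X (ζ - η) * Y η) :=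
          lintegral_lintegral_swap (by fun_prop)
      _ = ∫⁻ η : Spacetime, (∫⁻ τ, κ (τ + η 1) ^ 2 * timeMarginal X τ) * Y η := by
          refine lintegral_congr fun η => ?_
          simp only [← mul_assoc]
          rw [lintegral_mul_const _ (by fun_prop), ← lintegral_mul_time hX (by fun_prop),
            ← lintegral_sub_right_eq_self (fun ζ : Spacetime => κ (ζ 1 + η 1) ^ 2 * X ζ) η]
          simp
      _ = ∫⁻ t, (∫⁻ τ, κ (τ + t) ^ 2 * timeMarginal X τ) * timeMarginal Y t :=
          lintegral_mul_time hY (Measurable.lintegral_prod_right'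
            (f := fun z : ℝ × ℝ => κ (z.2 + z.1) ^ 2 * timeMarginal X z.2) (by fun_prop))
      _ = _ := by
          simp only [pow_two, mul_assoc, mul_comm]
  change (∫⁻ ζ : Spacetime, ENNReal.ofReal ((1 + |ζ 1|) ^ (-2 : ℝ)) *
    ∫⁻ η, X (ζ - η) * Y η) ^ 2 ≤ _
  rw [hred]
  refine (sq_lintegral_kernel_le volume volume (k := fun t τ => κ (τ + t))
    (Ψ := fun t τ => κ (τ + t) * timeMarginal X τ) hYm
    (by simp only [Function.uncurry_def]; fun_prop)
    (by simp only [Function.uncurry_def]; fun_prop) hκD).trans ?_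
  have hΨ : ∫⁻ t, ∫⁻ τ, (κ (τ + t) * timeMarginal X τ) ^ 2 ≤
      ENNReal.ofReal D * ∫⁻ τ, timeMarginal X τ ^ 2 := by
    rw [lintegral_lintegral_swap (by fun_prop), ← lintegral_const_mul _ (by fun_prop)]
    refine lintegral_mono fun τ => ?_
    simp only [mul_pow]
    rw [lintegral_mul_const _ (by fun_prop)]
    gcongr
    simpa only [add_comm] using hκD τ
  calc ENNReal.ofReal D * (∫⁻ t, timeMarginal Y t ^ 2) *
        ∫⁻ t, ∫⁻ τ, (κ (τ + t) * timeMarginal X τ) ^ 2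
      ≤ ENNReal.ofReal D * (ENNReal.ofReal C * ∫⁻ ζ, G ζ ^ 2) *
          (ENNReal.ofReal D * (ENNReal.ofReal C * ∫⁻ ζ, F ζ ^ 2)) := by
        gcongr
        · exact h G hG
        · exact hΨ.trans (by gcongr; exact h F hF)
    _ = _ := by
        rw [ENNReal.ofReal_mul (by positivity), ENNReal.ofReal_mul (by positivity)]
        ring

/-! ### From the kernel to the Bourgain weights. -/

theorem sqrt_kdvKernelSq (ρ p q ξ τ ξ₁ τ₁ : ℝ) :
    √(kdvKernelSq ρ p q ξ τ ξ₁ τ₁) =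
      |ξ| * (1 + |ξ|) ^ (-ρ) * ((1 + |ξ₁|) * (1 + |ξ - ξ₁|)) ^ ρ *
        (1 + |τ - ξ ^ 3|) ^ (-(p / 2)) *
        ((1 + |τ₁ - ξ₁ ^ 3|) ^ (-(q / 2)) * (1 + |τ - τ₁ - (ξ - ξ₁) ^ 3|) ^ (-(q / 2))) := by
  have hsq : ∀ x r : ℝ, 0 ≤ x → (x ^ r) ^ 2 = x ^ (2 * r) := fun x r hx => by
    rw [← Real.rpow_natCast, ← Real.rpow_mul hx, mul_comm]
    norm_num
  rw [← Real.sqrt_sq (show 0 ≤ |ξ| * (1 + |ξ|) ^ (-ρ) * ((1 + |ξ₁|) * (1 + |ξ - ξ₁|)) ^ ρ *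
        (1 + |τ - ξ ^ 3|) ^ (-(p / 2)) * ((1 + |τ₁ - ξ₁ ^ 3|) ^ (-(q / 2)) *
          (1 + |τ - τ₁ - (ξ - ξ₁) ^ 3|) ^ (-(q / 2))) by positivity)]
  congr 1
  simp only [mul_pow (M := ℝ), sq_abs]
  rw [hsq _ _ (by positivity), hsq _ _ (by positivity), hsq _ _ (by positivity),
    hsq _ _ (by positivity), hsq _ _ (by positivity)]
  unfold kdvKernelSq
  ring_nf

theorem bourgainWeight_nonneg (σ s b : ℝ) (ζ : Spacetime) : 0 ≤ bourgainWeight σ s b ζ := by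
  unfold bourgainWeight
  positivity

theorem measurable_bourgainWeight (σ s b : ℝ) : Measurable (bourgainWeight σ s b) := by
  unfold bourgainWeight
  fun_prop

/-- The triangle inequality in frequency handles $e^{\sigma|\xi|}$, and
$1+|\xi|\le(1+|\xi_1|)(1+|\xi-\xi_1|)$ raised to the power $\rho+s\ge0$ replaces $s$ by $-\rho$. The
kernel on the right is therefore free of $\sigma$ and $s$. -/
theorem abs_mul_bourgainWeight_le {σ s ρ : ℝ} (hσ : 0 ≤ σ) (hs : -ρ ≤ s) (p q : ℝ)
    (ζ η : Spacetime) :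
    |ζ 0| * bourgainWeight σ s (-(p / 2)) ζ ≤ √(kdvKernelSq ρ p q (ζ 0) (ζ 1) (η 0) (η 1)) *
      (bourgainWeight σ s (q / 2) η * bourgainWeight σ s (q / 2) (ζ - η)) := by
  rw [sqrt_kdvKernelSq]
  simp only [bourgainWeight, PiLp.sub_apply]
  generalize ζ 0 = ξ, ζ 1 = τ, η 0 = ξ₁, η 1 = τ₁
  have hcancel : ∀ y : ℝ, (1 + |y|) ^ (-(q / 2)) * (1 + |y|) ^ (q / 2) = 1 := fun y => by
    rw [← Real.rpow_add (by positivity), neg_add_cancel, Real.rpow_zero]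
  have htri : |ξ| ≤ |ξ₁| + |ξ - ξ₁| := by
    simpa using abs_add_le ξ₁ (ξ - ξ₁)
  have hexp : Real.exp (σ * |ξ|) ≤ Real.exp (σ * |ξ₁|) * Real.exp (σ * |ξ - ξ₁|) := by
    rw [← Real.exp_add, ← mul_add]
    gcongr
  have hfreq : (1 + |ξ|) ^ s ≤ (1 + |ξ|) ^ (-ρ) * ((1 + |ξ₁|) * (1 + |ξ - ξ₁|)) ^ ρ *
      ((1 + |ξ₁|) ^ s * (1 + |ξ - ξ₁|) ^ s) := by
    calc (1 + |ξ|) ^ s = (1 + |ξ|) ^ (-ρ) * (1 + |ξ|) ^ (ρ + s) := by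
          rw [← Real.rpow_add (by positivity)]
          ring_nf
      _ ≤ (1 + |ξ|) ^ (-ρ) * ((1 + |ξ₁|) * (1 + |ξ - ξ₁|)) ^ (ρ + s) := by
          have h : 1 + |ξ| ≤ (1 + |ξ₁|) * (1 + |ξ - ξ₁|) := by
            nlinarith [mul_nonneg (abs_nonneg ξ₁) (abs_nonneg (ξ - ξ₁))]
          have h' : 0 ≤ ρ + s := by linarith
          gcongr
      _ = _ := by
          rw [Real.rpow_add (by positivity),
            Real.mul_rpow (z := s) (by positivity) (by positivity)]
          ring
  calc |ξ| * (Real.exp (σ * |ξ|) * (1 + |ξ|) ^ s * (1 + |τ - ξ ^ 3|) ^ (-(p / 2)))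
      ≤ |ξ| * ((Real.exp (σ * |ξ₁|) * Real.exp (σ * |ξ - ξ₁|)) *
          ((1 + |ξ|) ^ (-ρ) * ((1 + |ξ₁|) * (1 + |ξ - ξ₁|)) ^ ρ *
            ((1 + |ξ₁|) ^ s * (1 + |ξ - ξ₁|) ^ s)) * (1 + |τ - ξ ^ 3|) ^ (-(p / 2))) := by gcongr
    _ = |ξ| * ((Real.exp (σ * |ξ₁|) * Real.exp (σ * |ξ - ξ₁|)) *
          ((1 + |ξ|) ^ (-ρ) * ((1 + |ξ₁|) * (1 + |ξ - ξ₁|)) ^ ρ *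
            ((1 + |ξ₁|) ^ s * (1 + |ξ - ξ₁|) ^ s)) * (1 + |τ - ξ ^ 3|) ^ (-(p / 2))) *
        ((1 + |τ₁ - ξ₁ ^ 3|) ^ (-(q / 2)) * (1 + |τ₁ - ξ₁ ^ 3|) ^ (q / 2)) *
        ((1 + |τ - τ₁ - (ξ - ξ₁) ^ 3|) ^ (-(q / 2)) *
          (1 + |τ - τ₁ - (ξ - ξ₁) ^ 3|) ^ (q / 2)) := by
        rw [hcancel, hcancel, mul_one, mul_one]
    _ = _ := by ring

theorem one_le_smoothingWeight_mul {σ s q : ℝ} (hσ : 0 ≤ σ) (hs : -1 ≤ s) (ζ : Spacetime) :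
    1 ≤ smoothingWeight q ζ * ENNReal.ofReal (bourgainWeight σ s (q / 2) ζ) := by
  rw [smoothingWeight, ← ENNReal.ofReal_mul (by positivity), ENNReal.one_le_ofReal]
  unfold bourgainWeight
  have h1 : (1 + |ζ 1 - ζ 0 ^ 3|) ^ (-(q / 2)) * (1 + |ζ 1 - ζ 0 ^ 3|) ^ (q / 2) = 1 := by
    rw [← Real.rpow_add (by positivity), neg_add_cancel, Real.rpow_zero]
  have h2 : 1 ≤ (1 + |ζ 0|) * (1 + |ζ 0|) ^ s := by
    nth_rw 1 [← Real.rpow_one (1 + |ζ 0|)]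
    rw [← Real.rpow_add (by positivity)]
    exact Real.one_le_rpow (by linarith [abs_nonneg (ζ 0)]) (by linarith)
  have h3 : 1 ≤ Real.exp (σ * |ζ 0|) := Real.one_le_exp (by positivity)
  calc (1 : ℝ) ≤ Real.exp (σ * |ζ 0|) * ((1 + |ζ 0|) * (1 + |ζ 0|) ^ s) * 1 := by
        rw [mul_one]
        exact one_le_mul_of_one_le_of_one_le h3 h2
    _ = Real.exp (σ * |ζ 0|) * ((1 + |ζ 0|) * (1 + |ζ 0|) ^ s) *
          ((1 + |ζ 1 - ζ 0 ^ 3|) ^ (-(q / 2)) * (1 + |ζ 1 - ζ 0 ^ 3|) ^ (q / 2)) := by rw [h1]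
    _ = _ := by ring

theorem enorm_complex_ofReal (x : ℝ) : ‖(x : ℂ)‖ₑ = ‖x‖ₑ := by
  rw [← ofReal_norm, ← ofReal_norm, Complex.norm_real]

theorem enorm_bourgainWeight_mul (σ s b : ℝ) (ζ : Spacetime) (z : ℂ) :
    ‖(bourgainWeight σ s b ζ : ℂ) * z‖ₑ = ENNReal.ofReal (bourgainWeight σ s b ζ) * ‖z‖ₑ := by
  rw [enorm_mul, enorm_complex_ofReal, Real.enorm_of_nonneg (bourgainWeight_nonneg σ s b ζ)]

theorem eLpNorm_two_sq {α E : Type*} [MeasurableSpace α] [NormedAddCommGroup E] (μ : Measure α)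
    (f : α → E) : eLpNorm f 2 μ ^ 2 = ∫⁻ x, ‖f x‖ₑ ^ 2 ∂μ := by
  have h := eLpNorm_nnreal_pow_eq_lintegral (μ := μ) (f := f) (p := 2) two_ne_zero
  simpa using h

/-! ### The convolution of two transforms. -/

section Convolution

variable {f g : Spacetime → ℂ} {σ s q : ℝ}

theorem lintegral_enorm_convolution_lt_top (hq : 1 < q) (hσ : 0 ≤ σ) (hs : -1 ≤ s)
    (hf : Measurable f) (hg : Measurable g)
    (hf' : eLpNorm (fun ζ => (bourgainWeight σ s (q / 2) ζ : ℂ) * f ζ) 2 volume < ∞)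
    (hg' : eLpNorm (fun ζ => (bourgainWeight σ s (q / 2) ζ : ℂ) * g ζ) 2 volume < ∞) :
    ∫⁻ ζ : Spacetime, ENNReal.ofReal ((1 + |ζ 1|) ^ (-2 : ℝ)) *
      ∫⁻ η, ‖f (ζ - η)‖ₑ * ‖g η‖ₑ < ∞ := by
  obtain ⟨C, -, h⟩ := exists_lintegral_convolution_le hq
  have hw := measurable_bourgainWeight σ s (q / 2)
  have hle : ∀ (φ : Spacetime → ℂ) (ζ : Spacetime), ‖φ ζ‖ₑ ≤
      smoothingWeight q ζ * ‖(bourgainWeight σ s (q / 2) ζ : ℂ) * φ ζ‖ₑ := fun φ ζ => by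
    rw [enorm_bourgainWeight_mul, ← mul_assoc]
    exact le_mul_of_one_le_left' (one_le_smoothingWeight_mul hσ hs ζ)
  have h1 := h (fun ζ => ‖(bourgainWeight σ s (q / 2) ζ : ℂ) * f ζ‖ₑ)
    (fun ζ => ‖(bourgainWeight σ s (q / 2) ζ : ℂ) * g ζ‖ₑ) (by fun_prop) (by fun_prop)
  rw [← eLpNorm_two_sq, ← eLpNorm_two_sq] at h1
  have h2 := h1.trans_lt (ENNReal.mul_lt_top ENNReal.ofReal_lt_top
    (ENNReal.mul_lt_top (ENNReal.pow_lt_top hf') (ENNReal.pow_lt_top hg')))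
  refine lt_of_le_of_lt ?_ ((ENNReal.pow_lt_top_iff.1 h2).resolve_right two_ne_zero)
  gcongr with ζ η
  · exact hle f _
  · exact hle g _

theorem exists_eLpNorm_convolution_le {ρ p : ℝ} (hρ : ρ ≤ 3 / 4) (hp : 1 / 2 ≤ p)
    (hρ' : 1 / 2 ≤ ρ) (hθ : 0 ≤ 2 * ρ - p) (hθ' : 3 * (2 * ρ - p) ≤ 4 * ρ - 3 / 2)
    (hpq : p ≤ q) (hq : 1 < q) (hs : -ρ ≤ s) :
    ∃ C : ℝ, 0 < C ∧ ∀ σ : ℝ, 0 ≤ σ → ∀ f g : Spacetime → ℂ, Measurable f → Measurable g →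
      eLpNorm (fun ζ => (bourgainWeight σ s (-(p / 2)) ζ : ℂ) * (Complex.I * (ζ 0 : ℂ) *
        ((((2 * Real.pi) ^ 2 : ℂ)⁻¹ * ∫ η : Spacetime, f (ζ - η) * g η)))) 2 volume ≤
      ENNReal.ofReal C *
        eLpNorm (fun ζ => (bourgainWeight σ s (q / 2) ζ : ℂ) * f ζ) 2 volume *
        eLpNorm (fun ζ => (bourgainWeight σ s (q / 2) ζ : ℂ) * g ζ) 2 volume := by
  obtain ⟨C, hC, h⟩ := exists_lintegral_sq_kdvKernel_le hρ hp hρ' hθ hθ' hpq hq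
  refine ⟨√C, Real.sqrt_pos.2 hC, fun σ hσ f g hf hg => ?_⟩
  have hw := measurable_bourgainWeight σ s (q / 2)
  have hpi : ‖((2 * Real.pi) ^ 2 : ℂ)⁻¹‖ₑ ≤ 1 := by
    have h1 : (1 : ℝ) ≤ (2 * Real.pi) ^ 2 := one_le_pow₀ (by linarith [Real.pi_gt_three])
    rw [← ofReal_norm, ENNReal.ofReal_le_one, norm_inv, norm_pow, norm_mul,
      Complex.norm_real, Complex.norm_ofNat, Real.norm_of_nonneg Real.pi_pos.le]
    exact inv_le_one_of_one_le₀ h1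
  rw [← ENNReal.pow_le_pow_left_iff two_ne_zero, mul_pow (_ * _ : ℝ≥0∞),
    mul_pow (ENNReal.ofReal √C), ← ENNReal.ofReal_pow (Real.sqrt_nonneg _), Real.sq_sqrt hC.le, eLpNorm_two_sq, eLpNorm_two_sq,
    eLpNorm_two_sq, mul_assoc, mul_comm (∫⁻ x, ‖_ * f x‖ₑ ^ 2)]
  -- The $L^2$ estimate is applied with `g` first, since the convolution evaluates `g` at `η` and
  -- `f` at `ζ - η`.
  refine le_trans (lintegral_mono fun ζ => ?_)
    (h (fun ζ => ‖(bourgainWeight σ s (q / 2) ζ : ℂ) * g ζ‖ₑ)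
      (fun ζ => ‖(bourgainWeight σ s (q / 2) ζ : ℂ) * f ζ‖ₑ) (by fun_prop) (by fun_prop))
  dsimp only
  gcongr
  rw [enorm_bourgainWeight_mul, enorm_mul, enorm_mul, enorm_mul, enorm_complex_ofReal]
  calc ENNReal.ofReal (bourgainWeight σ s (-(p / 2)) ζ) * (‖Complex.I‖ₑ * ‖ζ 0‖ₑ *
        (‖((2 * Real.pi) ^ 2 : ℂ)⁻¹‖ₑ * ‖∫ η : Spacetime, f (ζ - η) * g η‖ₑ))
      ≤ ENNReal.ofReal (bourgainWeight σ s (-(p / 2)) ζ) * (1 * ‖ζ 0‖ₑ *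
        (1 * ∫⁻ η : Spacetime, ‖f (ζ - η) * g η‖ₑ)) := by
        gcongr
        · simp [← ofReal_norm]
        · exact enorm_integral_le_lintegral_enorm _
    _ = ∫⁻ η : Spacetime, ENNReal.ofReal (|ζ 0| * bourgainWeight σ s (-(p / 2)) ζ) *
          (‖g η‖ₑ * ‖f (ζ - η)‖ₑ) := by
        rw [lintegral_const_mul _ (by fun_prop), ENNReal.ofReal_mul (abs_nonneg _),
          ← Real.enorm_eq_ofReal_abs]
        simp only [enorm_mul, mul_comm ‖g _‖ₑ]
        ring
    _ ≤ ∫⁻ η : Spacetime, kdvKernel ρ p q ζ η *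
          (‖(bourgainWeight σ s (q / 2) η : ℂ) * g η‖ₑ *
            ‖(bourgainWeight σ s (q / 2) (ζ - η) : ℂ) * f (ζ - η)‖ₑ) := by
        refine lintegral_mono fun η => ?_
        simp only [enorm_bourgainWeight_mul]
        calc _ ≤ ENNReal.ofReal (√(kdvKernelSq ρ p q (ζ 0) (ζ 1) (η 0) (η 1)) *
              (bourgainWeight σ s (q / 2) η * bourgainWeight σ s (q / 2) (ζ - η))) *
              (‖g η‖ₑ * ‖f (ζ - η)‖ₑ) := by
              exact mul_le_mul' (ENNReal.ofReal_le_ofReal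
                (abs_mul_bourgainWeight_le hσ hs p q ζ η)) le_rfl
          _ = _ := by
              rw [ENNReal.ofReal_mul (Real.sqrt_nonneg _),
                ENNReal.ofReal_mul (bourgainWeight_nonneg _ _ _ _), kdvKernel]
              ring

/-- The positive weight makes the inner integral finite almost everywhere. As
$(1+\|\zeta\|^2)^{-1}\le2(1+|\tau|)^{-2}$, the same bound gives the integrability needed to define a
tempered distribution. -/
theorem integrable_convolution_and_weighted (hf : Measurable f) (hg : Measurable g)
    (h : ∫⁻ ζ : Spacetime, ENNReal.ofReal ((1 + |ζ 1|) ^ (-2 : ℝ)) *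
      ∫⁻ η, ‖f (ζ - η)‖ₑ * ‖g η‖ₑ < ∞) (c : ℂ) :
    (∀ᵐ ζ : Spacetime, Integrable (fun η : Spacetime => f (ζ - η) * g η)) ∧
      Integrable (fun ζ : Spacetime => ((1 + ‖ζ‖ ^ 2)⁻¹ : ℝ) *
        (c * ∫ η : Spacetime, f (ζ - η) * g η)) := by
  have hprod : Measurable fun z : Spacetime × Spacetime => f (z.1 - z.2) * g z.2 := by fun_prop
  have hN : Measurable fun ζ : Spacetime => ∫⁻ η, ‖f (ζ - η)‖ₑ * ‖g η‖ₑ :=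
    Measurable.lintegral_prod_right' (f := fun z : Spacetime × Spacetime =>
      ‖f (z.1 - z.2)‖ₑ * ‖g z.2‖ₑ) (by fun_prop)
  constructor
  · filter_upwards [ae_lt_top (by fun_prop) h.ne] with ζ hζ
    refine ⟨by fun_prop, ?_⟩
    rw [hasFiniteIntegral_iff_enorm]
    simp only [enorm_mul]
    refine ENNReal.lt_top_of_mul_ne_top_right hζ.ne ?_
    exact (ENNReal.ofReal_pos.2 (by positivity)).ne'
  · have hm : StronglyMeasurable fun ζ : Spacetime => ∫ η : Spacetime, f (ζ - η) * g η :=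
      hprod.stronglyMeasurable.integral_prod_right'
    refine ⟨by
      refine Measurable.aestronglyMeasurable ?_
      have := hm.measurable
      fun_prop, ?_⟩
    rw [hasFiniteIntegral_iff_enorm]
    refine lt_of_le_of_lt ?_ (ENNReal.mul_lt_top (a := 2 * ‖c‖ₑ) (by
      simp [ENNReal.mul_lt_top_iff]) h)
    rw [← lintegral_const_mul _ (by fun_prop)]
    refine lintegral_mono fun ζ => ?_
    dsimp only
    have hwt : (1 + ‖ζ‖ ^ 2)⁻¹ ≤ 2 * (1 + |ζ 1|) ^ (-2 : ℝ) := by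
      have h1 : |ζ 1| ≤ ‖ζ‖ := PiLp.norm_apply_le ζ 1
      have h2 : |ζ 1| ^ 2 ≤ ‖ζ‖ ^ 2 := by gcongr
      rw [Real.rpow_neg (by positivity), Real.rpow_two, ← div_eq_mul_inv, inv_eq_one_div,
        div_le_div_iff₀ (by positivity) (by positivity)]
      nlinarith [sq_nonneg (|ζ 1| - 1)]
    calc ‖(((1 + ‖ζ‖ ^ 2)⁻¹ : ℝ) : ℂ) * (c * ∫ η : Spacetime, f (ζ - η) * g η)‖ₑ
        = ENNReal.ofReal ((1 + ‖ζ‖ ^ 2)⁻¹) * (‖c‖ₑ * ‖∫ η : Spacetime, f (ζ - η) * g η‖ₑ) := by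
          rw [enorm_mul, enorm_mul, enorm_complex_ofReal, Real.enorm_of_nonneg (by positivity)]
      _ ≤ ENNReal.ofReal (2 * (1 + |ζ 1|) ^ (-2 : ℝ)) *
            (‖c‖ₑ * ∫⁻ η, ‖f (ζ - η)‖ₑ * ‖g η‖ₑ) := by
          gcongr
          refine (enorm_integral_le_lintegral_enorm _).trans_eq ?_
          simp only [enorm_mul]
      _ = _ := by
          rw [ENNReal.ofReal_mul (by norm_num), ENNReal.ofReal_ofNat]
          ring

end Convolution

/-! ### Choice of exponents and conclusion. -/

theorem MemBourgain.exists_measurable {σ s b : ℝ} {u : 𝓢'(Spacetime, ℂ)}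
    (hu : MemBourgain σ s b u) :
    ∃ f : Spacetime → ℂ, Measurable f ∧ IsSpacetimeFourier u f := by
  obtain ⟨f, hf⟩ := iInf_lt_iff.1 hu
  obtain ⟨hf', -⟩ := iInf_lt_iff.1 hf
  have hm := hf'.aestronglyMeasurable
  exact ⟨hm.mk f, hm.stronglyMeasurable_mk.measurable, hf'.congr hm.ae_eq_mk⟩

theorem corollary1 (s : ℝ) (hs : -3 / 4 < s) :
    ∃ b b' C : ℝ, 1 / 2 < b ∧ b < b' ∧ b' < 1 ∧ 0 < C ∧
      ∀ σ : ℝ, 0 ≤ σ → ∀ u v : 𝓢'(Spacetime, ℂ),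
        MemBourgain σ s b u → MemBourgain σ s b v →
          ∃ p : 𝓢'(Spacetime, ℂ), IsProduct u v p ∧
            MemBourgain σ s (b' - 1) (∂_{dirX} p) ∧
            bourgainNorm σ s (b' - 1) (∂_{dirX} p) ≤
              ENNReal.ofReal C * bourgainNorm σ s b u * bourgainNorm σ s b v := by
  -- The floor $5/8$ keeps $\rho\ge1/2$ when $s$ is large; the strict bound $\rho<3/4$ is where
  -- $s>-3/4$ enters.
  obtain ⟨ρ, hρs, hρ', hρ⟩ : ∃ ρ : ℝ, -s ≤ ρ ∧ 5 / 8 ≤ ρ ∧ ρ < 3 / 4 :=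
    ⟨max (-s) (5 / 8), le_max_left _ _, le_max_right _ _, max_lt (by linarith) (by norm_num)⟩
  obtain ⟨δ, hδ⟩ : ∃ δ : ℝ, δ = 3 / 4 - ρ := ⟨_, rfl⟩
  -- With $p=1-\delta/3$ one has $3(2\rho-p)=3/2-5\delta\le3/2-4\delta=4\rho-3/2$, the required
  -- budget. Here $b=q/2=1/2+\delta/12$ and $b'=1-p/2=1/2+\delta/6$, so $b<b'$.
  have hq : 1 < 1 + δ / 6 := by linarith
  obtain ⟨C, hC, h⟩ := exists_eLpNorm_convolution_le (s := s) (ρ := ρ) (p := 1 - δ / 3)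
    (q := 1 + δ / 6) hρ.le (by linarith) (by linarith) (by linarith) (by linarith) (by linarith)
    hq (by linarith)
  refine ⟨(1 + δ / 6) / 2, 1 / 2 + δ / 6, C, by linarith, by linarith, by linarith, hC,
    fun σ hσ u v hu hv => ?_⟩
  obtain ⟨f, hf, huf⟩ := hu.exists_measurable
  obtain ⟨g, hg, hvg⟩ := hv.exists_measurable
  have hb : 1 / 2 + δ / 6 - 1 = -((1 - δ / 3) / 2) := by ring
  unfold MemBourgain at hu hv ⊢
  rw [huf.bourgainNorm_eq] at hu ⊢
  rw [hvg.bourgainNorm_eq] at hv ⊢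
  obtain ⟨hae, hint⟩ := integrable_convolution_and_weighted hf hg
    (lintegral_enorm_convolution_lt_top hq hσ (by linarith) hf hg hu hv)
    ((2 * Real.pi) ^ 2 : ℂ)⁻¹
  obtain ⟨p, hp⟩ := exists_isSpacetimeFourier hint
  refine ⟨p, ⟨f, g, huf, hvg, hae, hp⟩, ?_⟩
  rw [hp.lineDeriv.bourgainNorm_eq, hb]
  have hle := h σ hσ f g hf hg
  exact ⟨hle.trans_lt (ENNReal.mul_lt_top (ENNReal.mul_lt_top ENNReal.ofReal_lt_top hu) hv), hle⟩
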